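/- Let $n$ be a natural number, let $S_n$ be the symmetric group with length function $\ell$ (number of inversions), Bruhat order $\le$ and longest element $w_\circ$, let $s_i$ be the transposition of $i$ and $i+1$, and put $\mathbb{Z}[q]=\mathbb{Z}[q_1,q_2,\ldots]$. On polynomials in $x=(x_1,x_2,\ldots)$ (over any coefficient ring not involving $x$) let $\partial_i=\frac{1-s_i}{x_i-x_{i+1}}$, where $s_i$ exchanges $x_i$ and $x_{i+1}$, let $\pi_i=1+(1-x_i)\partial_i$, and let $\pi_w=\pi_{i_1}\cdots\pi_{i_l}$ for a reduced decomposition $w=s_{i_1}\cdots s_{i_l}$. Define the following polynomials. * The Grothendieck polynomials $\mathfrak{G}_w(x)=\pi_{w^{-1}w_\circ}\bigl(x_1^{n-1}x_2^{n-2}\cdots x_{n-1}\bigr)$ and the dual Grothendieck polynomials $\mathfrak{H}_w(x)=\sum_{v\in S_n,\,v\ge w}(-1)^{\ell(v)-\ell(w)}\mathfrak{G}_v(x)$, for $w\in S_n$. * For $0\le p\le k$, $e_p^k=e_p(x_1,\ldots,x_k)$ (elementary symmetric polynomial), $$F_p^k(x)=\sum_{I\subseteq\{1,\ldots,k\},\,|I|=p}\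 \prod_{i\in I}(1-x_i)\prod_{i\in I,\,i+1\notin I}(1-q_i),\qquad \widehat{E}_p^k(x)=\sum_{i=0}^p(-1)^i\binom{k-i}{p-i}F_i^k(x).$$ * Let $L_n^q$ be the free $\mathbb{Z}[q]$-module spanned by the monomials $x_1^{i_1}\cdots x_{n-1}^{i_{n-1}}$ with $0\le i_j\le n-j$. The products $e_{p_1}^1\cdots e_{p_{n-1}}^{n-1}$ with $0\le p_k\le k$ form a $\mathbb{Z}[q]$-basis of $L_n^q$, and $\mathfrak{G}_w\in L_n^q$ for $w\in S_n$. Let $\widehat{Q}$ be the $\mathbb{Z}[q]$-linear map on $L_n^q$ with $\widehat{Q}(e_{p_1}^1\cdots e_{p_{n-1}}^{n-1})=\widehat{E}_{p_1}^1\cdots\widehat{E}_{p_{n-1}}^{n-1}$. The quantum Grothendieck polynomial of $w\in S_n$ is $\mathfrak{G}^q_w=\widehat{Q}(\mathfrak{G}_w)$. * The quantum double Grothendieck polynomials are $$\mathfrak{G}^q_{w_\circ}(x,y)=\prod_{i=1}^{n-1}\Bigl(1+\sum_{j=1}^{i}(-1)^j(1-x_{n-i})^jF_j^i(y)\Bigr)$$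 and $\mathfrak{G}^q_w(x,y)=\pi^{(x)}_{w^{-1}w_\circ}\mathfrak{G}^q_{w_\circ}(x,y)$ for $w\in S_n$, where $\pi^{(x)}$ acts on the $x$ variables only. **Theorem (Cauchy identity).** In $\mathbb{Z}[q][x,y]$ we have $$\mathfrak{G}^q_{w_\circ}(x,y)=\sum_{w\in S_n}\mathfrak{H}_w(x)\,\mathfrak{G}^q_{ww_\circ}(y).$$ -/

import Mathlib

noncomputable section

namespace QuantumGrothendieck

open MvPolynomial Finset

/- Conventions.  `MvPolynomial ℕ R` is the ring `R[x₁, x₂, …]`, where `X i` stands for `x_i` with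
`i ≥ 1`; the variable with index `0` is never used.  The symmetric group `S_n` is
`Equiv.Perm (Fin n)`, positions and values being numbered from `0` to `n - 1`, and
`(u * w) i = u (w i)`. -/

/-! ### Divided differences -/

section DividedDifferences

variable {R : Type*} [CommRing R]

/-- The action of the transposition of `x_i` and `x_{i+1}` on polynomials. -/
def swapVars (i : ℕ) : MvPolynomial ℕ R →ₐ[R] MvPolynomial ℕ R :=
  rename (Equiv.swap i (i + 1))

theorem dvd_sub_swapVars (i : ℕ) (f : MvPolynomial ℕ R) :
    (X i - X (i + 1) : MvPolynomial ℕ R) ∣ f - swapVars i f := by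
  rw [← Ideal.mem_span_singleton, ← Ideal.Quotient.eq]
  set I : Ideal (MvPolynomial ℕ R) := Ideal.span {X i - X (i + 1)}
  have hX : Ideal.Quotient.mk I (X i) = Ideal.Quotient.mk I (X (i + 1)) :=
    Ideal.Quotient.eq.2 (Ideal.mem_span_singleton_self _)
  induction f using MvPolynomial.induction_on with
  | C a => simp [swapVars]
  | add p q hp hq => simp only [map_add, hp, hq]
  | mul_X p k hp =>
    simp only [map_mul, hp]
    congr 1
    simp only [swapVars, rename_X]
    rcases eq_or_ne k i with rfl | h1
    · simpa using hX
    rcases eq_or_ne k (i + 1) with rfl | h2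
    · simpa using hX.symm
    · rw [Equiv.swap_apply_of_ne_of_ne h1 h2]

/-- The divided difference operator `∂_i = (1 - s_i) / (x_i - x_{i+1})`. -/
def divDiff (i : ℕ) (f : MvPolynomial ℕ R) : MvPolynomial ℕ R :=
  Classical.choose (dvd_sub_swapVars i f)

theorem divDiff_spec (i : ℕ) (f : MvPolynomial ℕ R) :
    f - swapVars i f = (X i - X (i + 1)) * divDiff i f :=
  Classical.choose_spec (dvd_sub_swapVars i f)

/-- The isobaric divided difference operator `π_i = 1 + (1 - x_i) ∂_i`. -/
def isobaric (i : ℕ) (f : MvPolynomial ℕ R) : MvPolynomial ℕ R :=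
  f + (1 - X i) * divDiff i f

end DividedDifferences

/-! ### The symmetric group -/

section SymmetricGroup

variable {n : ℕ}

/-- The adjacent transposition `s_{i+1}` in `S_n`, for `i = 0, …, n - 2`. -/
def simple (i : Fin (n - 1)) : Equiv.Perm (Fin n) :=
  Equiv.swap ⟨i, by omega⟩ ⟨i + 1, by omega⟩

/-- `l` is a reduced decomposition of `w`: a shortest word in the adjacent transpositions with
product `w`. -/
def IsReducedWord (l : List (Fin (n - 1))) (w : Equiv.Perm (Fin n)) : Prop :=
  (l.map simple).prod = w ∧
    ∀ l' : List (Fin (n - 1)), (l'.map simple).prod = w → l.length ≤ l'.length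

theorem exists_word (w : Equiv.Perm (Fin n)) :
    ∃ l : List (Fin (n - 1)), (l.map simple).prod = w := by
  cases n with
  | zero => exact ⟨[], Subsingleton.elim _ _⟩
  | succ m =>
    have h := Equiv.Perm.mclosure_swap_castSucc_succ m
    have hw : w ∈ Submonoid.closure
        (Set.range fun i : Fin m => Equiv.swap i.castSucc i.succ) := by rw [h]; trivial
    obtain ⟨l, hl, rfl⟩ := Submonoid.exists_list_of_mem_closure hw
    clear hw
    induction l with
    | nil => exact ⟨[], rfl⟩
    | cons a l ih =>
      obtain ⟨l', hl'⟩ := ih (fun y hy => hl y (List.mem_cons_of_mem _ hy))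
      obtain ⟨i, hi⟩ := hl a List.mem_cons_self
      refine ⟨i :: l', ?_⟩
      rw [List.map_cons, List.prod_cons, List.prod_cons, hl', ← hi]
      rfl

theorem exists_isReducedWord (w : Equiv.Perm (Fin n)) :
    ∃ l : List (Fin (n - 1)), IsReducedWord l w := by
  classical
  have h : ∃ k, ∃ l : List (Fin (n - 1)), (l.map simple).prod = w ∧ l.length = k := by
    obtain ⟨l, hl⟩ := exists_word w
    exact ⟨_, l, hl, rfl⟩
  obtain ⟨l, hl, hk⟩ := Nat.find_spec h
  exact ⟨l, hl, fun l' hl' => hk ▸ Nat.find_min' h ⟨l', hl', rfl⟩⟩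

/-- A reduced decomposition of `w`. -/
def reducedWord (w : Equiv.Perm (Fin n)) : List (Fin (n - 1)) :=
  Classical.choose (exists_isReducedWord w)

/-- The operator `π_w = π_{i_1} ⋯ π_{i_l}` for a reduced decomposition
`w = s_{i_1} ⋯ s_{i_l}`. -/
def isobaricPerm {R : Type*} [CommRing R] (w : Equiv.Perm (Fin n)) (f : MvPolynomial ℕ R) :
    MvPolynomial ℕ R :=
  (reducedWord w).foldr (fun (i : Fin (n - 1)) g => isobaric ((i : ℕ) + 1) g) f

/-- The length `ℓ(w)`, that is, the number of inversions of `w`. -/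
def length (w : Equiv.Perm (Fin n)) : ℕ :=
  #{p : Fin n × Fin n | p.1 < p.2 ∧ w p.2 < w p.1}

/-- The Bruhat order on `S_n`: the reflexive and transitive closure of the relation
`v ⋖ v t_{ab}` where `ℓ(v t_{ab}) = ℓ(v) + 1`. -/
def BruhatLE (v w : Equiv.Perm (Fin n)) : Prop :=
  Relation.ReflTransGen
    (fun u u' : Equiv.Perm (Fin n) =>
      ∃ a b : Fin n, u' = u * Equiv.swap a b ∧ length u' = length u + 1) v w

/-- The longest element `w_∘ = n, n - 1, …, 1` of `S_n`. -/
def longest (n : ℕ) : Equiv.Perm (Fin n) := Fin.revPerm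

end SymmetricGroup

/-! ### Grothendieck polynomials and dual Grothendieck polynomials -/

section Classical

variable (R : Type*) [CommRing R] {n : ℕ}

/-- The Grothendieck polynomial `𝔊_w(x) = π_{w⁻¹ w_∘} (x₁^{n-1} x₂^{n-2} ⋯ x_{n-1})`, with
coefficients in `R` (they are integers). -/
def grothendieck (w : Equiv.Perm (Fin n)) : MvPolynomial ℕ R :=
  isobaricPerm (w⁻¹ * longest n) (∏ i ∈ Icc 1 (n - 1), X i ^ (n - i))

open Classical in
/-- The dual Grothendieck polynomial `ℌ_w = ∑_{v ≥ w} (-1)^{ℓ(v) - ℓ(w)} 𝔊_v`. -/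
def dualGrothendieck (w : Equiv.Perm (Fin n)) : MvPolynomial ℕ R :=
  ∑ v : Equiv.Perm (Fin n) with BruhatLE w v, (-1) ^ (length v - length w) * grothendieck R v

end Classical

/-! ### The module `L_n` -/

section StaircaseModule

/-- The exponents `(i_1, …, i_{n-1})` with `0 ≤ i_j ≤ n - j`. -/
def stairExponents (n : ℕ) : Set (ℕ →₀ ℕ) :=
  {a | a 0 = 0 ∧ ∀ j, a j ≤ n - j}

/-- The module `L_n`, spanned over `R` by the monomials `x_1^{i_1} ⋯ x_{n-1}^{i_{n-1}}` with
`0 ≤ i_j ≤ n - j`. -/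
def stairModule (R : Type*) [CommRing R] (n : ℕ) : Submodule R (MvPolynomial ℕ R) :=
  Submodule.span R ((fun a => monomial a (1 : R)) '' stairExponents n)

theorem stairModule_eq (R : Type*) [CommRing R] (n : ℕ) :
    stairModule R n = restrictSupport R (stairExponents n) :=
  (restrictSupport_eq_span R _).symm

theorem mem_stairModule_iff {R : Type*} [CommRing R] {n : ℕ} {f : MvPolynomial ℕ R} :
    f ∈ stairModule R n ↔ degreeOf 0 f = 0 ∧ ∀ j, degreeOf j f ≤ n - j := by
  rw [stairModule_eq, mem_restrictSupport_iff]
  simp only [← Nat.le_zero, degreeOf_le_iff]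
  constructor
  · intro h
    exact ⟨fun m hm => (h hm).1.le, fun j m hm => (h hm).2 j⟩
  · intro h m hm
    exact ⟨Nat.le_zero.1 (h.1 m hm), fun j => h.2 j m hm⟩

theorem isobaric_mem_stairModule {R : Type*} [CommRing R] [IsDomain R] {n i : ℕ} (hi : 1 ≤ i)
    (hin : i < n) {f : MvPolynomial ℕ R} (hf : f ∈ stairModule R n) :
    isobaric i f ∈ stairModule R n := by
  classical
  by_cases hg : divDiff i f = 0
  · simpa [isobaric, hg] using hf
  rw [mem_stairModule_iff] at hf ⊢
  obtain ⟨hf0, hf⟩ := hf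
  have hsw : ∀ j, degreeOf j (swapVars i f) = degreeOf (Equiv.swap i (i + 1) j) f := by
    intro j
    have := degreeOf_rename_of_injective (p := f) (Equiv.swap i (i + 1)).injective
      (Equiv.swap i (i + 1) j)
    rwa [Equiv.swap_apply_self] at this
  have hne : (X i - X (i + 1) : MvPolynomial ℕ R) ≠ 0 := by
    rw [sub_ne_zero]
    intro h
    have := X_injective h
    omega
  have hmul : ∀ j, degreeOf j (X i - X (i + 1) : MvPolynomial ℕ R) + degreeOf j (divDiff i f) ≤
      max (degreeOf j f) (degreeOf (Equiv.swap i (i + 1) j) f) := by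
    intro j
    rw [← degreeOf_mul_eq hne hg, ← divDiff_spec, ← hsw]
    exact degreeOf_sub_le _ _ _
  have hlin : ∀ j, j = i ∨ j = i + 1 → 1 ≤ degreeOf j (X i - X (i + 1) : MvPolynomial ℕ R) := by
    intro j hj
    have hc : coeff (Finsupp.single j 1) (X i - X (i + 1) : MvPolynomial ℕ R) ≠ 0 := by
      rcases hj with rfl | rfl <;> simp [coeff_X, Finsupp.single_left_inj]
    have := monomial_le_degreeOf j (mem_support_iff.2 hc)
    simpa using this
  have hpi : ∀ j, degreeOf j (isobaric i f) ≤
      max (degreeOf j f) ((if j = i then 1 else 0) + degreeOf j (divDiff i f)) := by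
    intro j
    refine (degreeOf_add_le _ _ _).trans (max_le_max le_rfl ?_)
    refine (degreeOf_mul_le _ _ _).trans (Nat.add_le_add_right ?_ _)
    refine (degreeOf_sub_le _ _ _).trans ?_
    simp [degreeOf_X]
  have key : ∀ j, degreeOf j (isobaric i f) ≤ max (degreeOf j f) (n - j) ∧
      (j = 0 → degreeOf j (isobaric i f) ≤ 0) := by
    intro j
    have h1 := hpi j
    have h2 := hmul j
    have h3 := hlin j
    have h4 := hf j
    have h5 := hf i
    have h6 := hf (i + 1)
    rcases eq_or_ne j i with rfl | hji
    · rw [Equiv.swap_apply_left] at h2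
      simp only [if_true, true_or, forall_const] at h1 h3
      omega
    rcases eq_or_ne j (i + 1) with rfl | hji'
    · rw [Equiv.swap_apply_right] at h2
      simp only [if_neg hji, or_true, forall_const] at h1 h3
      omega
    · rw [Equiv.swap_apply_of_ne_of_ne hji hji', max_self] at h2
      simp only [if_neg hji] at h1
      refine ⟨by omega, ?_⟩
      rintro rfl
      omega
  refine ⟨Nat.le_zero.1 ((key 0).2 rfl), fun j => ?_⟩
  exact (key j).1.trans (max_le (hf j) le_rfl)

theorem grothendieck_mem_stairModule (R : Type*) [CommRing R] [IsDomain R] {n : ℕ}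
    (w : Equiv.Perm (Fin n)) : grothendieck R w ∈ stairModule R n := by
  have htop : (∏ i ∈ Icc 1 (n - 1), X i ^ (n - i) : MvPolynomial ℕ R) ∈ stairModule R n := by
    have : (∏ i ∈ Icc 1 (n - 1), X i ^ (n - i) : MvPolynomial ℕ R) =
        monomial (∑ i ∈ Icc 1 (n - 1), Finsupp.single i (n - i)) 1 := by
      rw [monomial_sum_one]
      exact Finset.prod_congr rfl fun i _ => X_pow_eq_monomial
    rw [this]
    refine Submodule.subset_span ⟨_, ⟨?_, fun j => ?_⟩, rfl⟩
    · simp only [Finsupp.finsetSum_apply, Finsupp.single_apply, Finset.sum_ite_eq', mem_Icc]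
      simp
    · simp only [Finsupp.finsetSum_apply, Finsupp.single_apply, Finset.sum_ite_eq']
      split_ifs <;> omega
  unfold grothendieck isobaricPerm
  induction reducedWord (w⁻¹ * longest n) with
  | nil => exact htop
  | cons i l ih => exact isobaric_mem_stairModule (by omega) (by omega) ih

end StaircaseModule


/-! ### Standard elementary monomials form a basis of `L_n` -/

section StandardElementary

/-- The elementary symmetric polynomial `e_p^k = e_p(x_1, …, x_k)`. -/
def elem (R : Type*) [CommRing R] (k p : ℕ) : MvPolynomial ℕ R :=
  ∑ I ∈ powersetCard p (Icc 1 k), ∏ i ∈ I, X i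

/-- Index set of the standard elementary monomials: sequences `(p_0, p_1, …, p_{n-1})` with
`0 ≤ p_k ≤ k` (the entry `p_0 = 0` carries no information). -/
abbrev StdIndex (n : ℕ) : Type := (k : Fin n) → Fin (k + 1)

/-- The standard elementary monomial `e_{p_1 … p_{n-1}} = e_{p_1}^1 ⋯ e_{p_{n-1}}^{n-1}`. -/
def stdElem (R : Type*) [CommRing R] {n : ℕ} (p : StdIndex n) : MvPolynomial ℕ R :=
  ∏ k : Fin n, elem R k (p k)

theorem degreeOf_elem_le (R : Type*) [CommRing R] (k p j : ℕ) :
    degreeOf j (elem R k p) ≤ if 1 ≤ j ∧ j ≤ k then 1 else 0 := by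
  classical
  refine (degreeOf_sum_le _ _ _).trans (Finset.sup_le fun I hI => ?_)
  rw [mem_powersetCard] at hI
  refine (degreeOf_prod_le _ _ _).trans ?_
  rcases subsingleton_or_nontrivial R with h | h
  · refine (Finset.sum_nonpos fun i _ => ?_).trans (Nat.zero_le _)
    rw [Subsingleton.elim (X i : MvPolynomial ℕ R) 0, degreeOf_zero]
  simp only [degreeOf_X, Finset.sum_ite_eq]
  by_cases hj : j ∈ I
  · have := mem_Icc.1 (hI.1 hj)
    simp [hj, this]
  · simp [hj]

theorem stdElem_mem_stairModule (R : Type*) [CommRing R] {n : ℕ} (p : StdIndex n) :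
    stdElem R p ∈ stairModule R n := by
  rw [mem_stairModule_iff]
  have h : ∀ j, degreeOf j (stdElem R p) ≤ ∑ k : Fin n, if 1 ≤ j ∧ j ≤ (k : ℕ) then 1 else 0 :=
    fun j => (degreeOf_prod_le _ _ _).trans (Finset.sum_le_sum fun k _ => degreeOf_elem_le R k _ j)
  refine ⟨by simpa using h 0, fun j => (h j).trans ?_⟩
  rw [Fin.sum_univ_eq_sum_range (fun k => if 1 ≤ j ∧ j ≤ k then 1 else 0) n, Finset.sum_boole]
  have : (range n).filter (fun k => 1 ≤ j ∧ j ≤ k) ⊆ Ico j n := by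
    intro k hk
    simp only [mem_filter, mem_range, mem_Ico] at hk ⊢
    omega
  simpa using Finset.card_le_card this

theorem prod_sub_eq_sum {A : Type*} [CommRing A] (z : A) (y : ℕ → A) (k : ℕ) :
    ∏ j ∈ Icc 1 k, (z - y j) = ∑ p : Fin (k + 1),
      z ^ (k - (p : ℕ)) * (-1) ^ (p : ℕ) * ∑ I ∈ powersetCard p (Icc 1 k), ∏ i ∈ I, y i := by
  classical
  have h1 : ∏ j ∈ Icc 1 k, (z - y j) = ∏ j ∈ Icc 1 k, (- y j + z) :=
    Finset.prod_congr rfl fun _ _ => by ring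
  rw [h1, Finset.prod_add, Finset.sum_powerset, Nat.card_Icc, Nat.add_sub_cancel,
    Fin.sum_univ_eq_sum_range (fun p => z ^ (k - p) * (-1) ^ p *
      ∑ I ∈ powersetCard p (Icc 1 k), ∏ i ∈ I, y i) (k + 1)]
  refine Finset.sum_congr rfl fun p _ => ?_
  rw [Finset.mul_sum]
  refine Finset.sum_congr rfl fun I hI => ?_
  rw [mem_powersetCard] at hI
  rw [Finset.prod_neg, Finset.prod_const, card_sdiff_of_subset hI.1, hI.2, Nat.card_Icc,
    Nat.add_sub_cancel]
  ring

theorem perm_eq_one_of_le {n : ℕ} (u : Equiv.Perm (Fin n)) (h : ∀ k, k ≤ u k) : u = 1 := by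
  have hs : ∑ k : Fin n, (k : ℕ) = ∑ k : Fin n, (u k : ℕ) :=
    (Equiv.sum_comp u (fun k : Fin n => (k : ℕ))).symm
  have := (Finset.sum_eq_sum_iff_of_le (fun k _ => Fin.le_def.1 (h k))).1 hs
  ext k
  exact (this k (mem_univ k)).symm

theorem card_stdIndex (n : ℕ) : Fintype.card (StdIndex n) = n.factorial := by
  rw [Fintype.card_pi]
  simp only [Fintype.card_fin]
  rw [Fin.prod_univ_eq_prod_range (fun k => k + 1) n, Finset.prod_range_add_one_eq_factorial]

theorem linearIndependent_stdElem (R : Type*) [CommRing R] [IsDomain R] (n : ℕ) :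
    LinearIndependent R (stdElem R : StdIndex n → MvPolynomial ℕ R) := by
  classical
  let y : Equiv.Perm (Fin n) → ℕ → MvPolynomial (Fin n) R := fun τ j =>
    if h : 1 ≤ j ∧ j ≤ n then X (τ ⟨j - 1, by omega⟩) else 0
  let E : Equiv.Perm (Fin n) ≃ StdIndex n := Fintype.equivOfCardEq (by
    rw [card_stdIndex, Fintype.card_perm, Fintype.card_fin])
  let A : Matrix (Equiv.Perm (Fin n)) (StdIndex n) (MvPolynomial (Fin n) R) := fun σ p =>
    ∏ k : Fin n, (X (σ k) ^ ((k : ℕ) - (p k : ℕ)) * (-1) ^ (p k : ℕ))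
  let B : Matrix (StdIndex n) (Equiv.Perm (Fin n)) (MvPolynomial (Fin n) R) := fun p τ =>
    aeval (y τ) (stdElem R p)
  have hAB : ∀ σ τ, (A * B) σ τ = ∏ k : Fin n, ∏ j ∈ Icc 1 (k : ℕ), (X (σ k) - y τ j) := by
    intro σ τ
    rw [Matrix.mul_apply]
    simp only [prod_sub_eq_sum]
    rw [Finset.prod_univ_sum, Fintype.piFinset_univ]
    refine Finset.sum_congr rfl fun p _ => ?_
    simp only [A, B, stdElem, elem, map_prod, map_sum, aeval_X, ← Finset.prod_mul_distrib]
  have hdiag : A * B = Matrix.diagonal fun σ => (A * B) σ σ := by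
    ext1 σ τ
    by_cases h : σ = τ
    · subst h; simp
    rw [Matrix.diagonal_apply_ne _ h, hAB]
    by_contra hne
    apply h
    have : τ⁻¹ * σ = 1 := by
      refine perm_eq_one_of_le _ fun k => ?_
      by_contra hlt
      rw [not_le] at hlt
      apply hne
      refine Finset.prod_eq_zero (mem_univ k) (Finset.prod_eq_zero
        (i := (((τ⁻¹ * σ) k : Fin n) : ℕ) + 1) (mem_Icc.2 ⟨by omega, ?_⟩) ?_)
      · exact Fin.lt_def.1 hlt
      · have : 1 ≤ (((τ⁻¹ * σ) k : Fin n) : ℕ) + 1 ∧ (((τ⁻¹ * σ) k : Fin n) : ℕ) + 1 ≤ n := by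
          omega
        simp only [y, dif_pos this, Nat.add_sub_cancel, Fin.eta]
        simp
    exact (inv_mul_eq_one.1 this).symm
  have hdet : (A * B).det ≠ 0 := by
    rw [hdiag, Matrix.det_diagonal]
    refine Finset.prod_ne_zero_iff.2 fun σ _ => ?_
    rw [hAB]
    refine Finset.prod_ne_zero_iff.2 fun k _ => Finset.prod_ne_zero_iff.2 fun j hj => ?_
    have hj' := mem_Icc.1 hj
    have : 1 ≤ j ∧ j ≤ n := by omega
    simp only [y, dif_pos this]
    rw [sub_ne_zero]
    intro h
    have := congrArg Fin.val (σ.injective (X_injective h))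
    simp only at this
    omega
  have hB : (B.submatrix E id).det ≠ 0 := by
    intro h
    apply hdet
    have : A * B = A.submatrix id E * B.submatrix E id := by
      rw [Matrix.submatrix_mul_equiv, Matrix.submatrix_id_id]
    rw [this, Matrix.det_mul, h, mul_zero]
  rw [Fintype.linearIndependent_iff]
  intro c hc
  have hv : Matrix.vecMul (fun σ => C (c (E σ)) : Equiv.Perm (Fin n) → MvPolynomial (Fin n) R)
      (B.submatrix E id) = 0 := by
    funext τ
    have h1 := congrArg (aeval (y τ)) hc
    rw [map_sum, map_zero] at h1
    rw [Matrix.vecMul, dotProduct, Pi.zero_apply, ← h1, ← Equiv.sum_comp E]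
    refine Finset.sum_congr rfl fun σ _ => ?_
    rw [Matrix.submatrix_apply, id_eq, map_smul, smul_eq_C_mul]
  have h0 := Matrix.eq_zero_of_vecMul_eq_zero hB hv
  intro p
  have := congrFun h0 (E.symm p)
  simpa using this

/-- The exponent vector attached to a sequence `(a_0, …, a_{n-1})` with `a_k ≤ k`: the variable
`x_{n-k}` gets the exponent `a_k`. -/
def stairIndexEquiv (n : ℕ) : StdIndex n ≃ stairExponents n where
  toFun a := ⟨∑ k : Fin n, Finsupp.single (n - (k : ℕ)) (a k : ℕ), by
    have h : ∀ j, (∑ k : Fin n, Finsupp.single (n - (k : ℕ)) (a k : ℕ)) j ≤ n - j := by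
      intro j
      rw [Finsupp.finsetSum_apply]
      by_cases hj : 1 ≤ j ∧ j ≤ n
      · rw [Finset.sum_eq_single ⟨n - j, by omega⟩]
        · have := (a ⟨n - j, by omega⟩).is_lt
          rw [Finsupp.single_apply]
          split_ifs
          · simp only at this ⊢; omega
          · omega
        · intro k _ hk
          rw [Finsupp.single_eq_of_ne]
          intro h
          exact hk (Fin.ext (by simp only; omega))
        · simp
      · rw [Finset.sum_eq_zero]
        · omega
        · intro k _
          rw [Finsupp.single_eq_of_ne]
          omega
    refine ⟨?_, h⟩
    rw [Finsupp.finsetSum_apply]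
    refine Finset.sum_eq_zero fun k _ => Finsupp.single_eq_of_ne ?_
    omega⟩
  invFun s := fun k => ⟨s.1 (n - (k : ℕ)), by have := s.2.2 (n - (k : ℕ)); omega⟩
  left_inv a := by
    funext k
    apply Fin.ext
    simp only [Finsupp.finsetSum_apply]
    rw [Finset.sum_eq_single k]
    · simp
    · intro l _ hl
      rw [Finsupp.single_eq_of_ne]
      intro h
      exact hl (Fin.ext (by omega))
    · simp
  right_inv s := by
    apply Subtype.ext
    ext j
    simp only [Finsupp.finsetSum_apply]
    by_cases hj : 1 ≤ j ∧ j ≤ n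
    · have hnj : n - (n - j) = j := by omega
      rw [Finset.sum_eq_single ⟨n - j, by omega⟩]
      · simp [hnj]
      · intro k _ hk
        rw [Finsupp.single_eq_of_ne]
        intro h
        exact hk (Fin.ext (by simp only; omega))
      · simp
    · have h0 : s.1 j = 0 := by
        rcases Nat.eq_zero_or_pos j with rfl | hpos
        · exact s.2.1
        · have := s.2.2 j
          omega
      rw [h0, Finset.sum_eq_zero]
      intro k _
      rw [Finsupp.single_eq_of_ne]
      omega

/-- The defining monomial basis of `L_n`. -/
def monomialBasis (R : Type*) [CommRing R] (n : ℕ) :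
    Module.Basis (StdIndex n) R (stairModule R n) :=
  ((basisRestrictSupport R (stairExponents n)).map
    (LinearEquiv.ofEq _ _ (stairModule_eq R n).symm)).reindex (stairIndexEquiv n).symm

theorem monomialBasis_repr (R : Type*) [CommRing R] (n : ℕ) (f : stairModule R n)
    (a : StdIndex n) :
    (monomialBasis R n).repr f a = coeff (stairIndexEquiv n a).1 (f : MvPolynomial ℕ R) := by
  rw [monomialBasis, Module.Basis.repr_reindex_apply, Equiv.symm_symm]
  rfl

/-- The standard elementary monomials as elements of `L_n`. -/
def stdElemMem (R : Type*) [CommRing R] {n : ℕ} (p : StdIndex n) : stairModule R n :=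
  ⟨stdElem R p, stdElem_mem_stairModule R p⟩

theorem map_stdElem {R S : Type*} [CommRing R] [CommRing S] (φ : R →+* S) {n : ℕ}
    (p : StdIndex n) : map φ (stdElem R p) = stdElem S p := by
  simp [stdElem, elem, map_prod, map_sum]

theorem isUnit_det_stdElem (R : Type*) [CommRing R] (n : ℕ) :
    IsUnit ((monomialBasis R n).toMatrix (stdElemMem R)).det := by
  by_contra hdet
  obtain ⟨I, hI, hmem⟩ := exists_max_ideal_of_mem_nonunits hdet
  let _ := Ideal.Quotient.field I
  have := Module.Finite.of_basis (monomialBasis (R ⧸ I) n)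
  set φ : R →+* R ⧸ I := Ideal.Quotient.mk I
  have hmap : (monomialBasis (R ⧸ I) n).toMatrix (stdElemMem (R ⧸ I)) =
      φ.mapMatrix ((monomialBasis R n).toMatrix (stdElemMem R)) := by
    ext a p
    rw [RingHom.mapMatrix_apply, Matrix.map_apply, Module.Basis.toMatrix_apply,
      Module.Basis.toMatrix_apply, monomialBasis_repr, monomialBasis_repr, stdElemMem, stdElemMem,
      ← coeff_map, map_stdElem]
  have h0 : ((monomialBasis (R ⧸ I) n).toMatrix (stdElemMem (R ⧸ I))).det = 0 := by
    rw [hmap, ← RingHom.map_det]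
    exact Ideal.Quotient.eq_zero_iff_mem.2 hmem
  have hli : LinearIndependent (R ⧸ I) (stdElemMem (R ⧸ I) : StdIndex n → _) :=
    LinearIndependent.of_comp (stairModule (R ⧸ I) n).subtype (linearIndependent_stdElem (R ⧸ I) n)
  have hunit := ((monomialBasis (R ⧸ I) n).is_basis_iff_det (v := stdElemMem (R ⧸ I))).1
    ⟨hli, hli.span_eq_top_of_card_eq_finrank' (by
      rw [Module.finrank_eq_card_basis (monomialBasis (R ⧸ I) n)])⟩
  rw [Module.Basis.det_apply, h0] at hunit
  exact not_isUnit_zero hunit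

/-- The standard elementary monomials form a basis of `L_n`. -/
def stdBasis (R : Type*) [CommRing R] (n : ℕ) : Module.Basis (StdIndex n) R (stairModule R n) :=
  have h := ((monomialBasis R n).is_basis_iff_det (v := stdElemMem R)).2
    (by rw [Module.Basis.det_apply]; exact isUnit_det_stdElem R n)
  Module.Basis.mk h.1 h.2.ge

theorem coe_stdBasis (R : Type*) [CommRing R] {n : ℕ} (p : StdIndex n) :
    (stdBasis R n p : MvPolynomial ℕ R) = stdElem R p := by
  simp [stdBasis, stdElemMem]

end StandardElementary

/-! ### Quantization -/

section Quantum

/-- The ring `ℤ[q] = ℤ[q_1, q_2, …]`; the variable `q_i` is `X i` with `i ≥ 1`. -/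
abbrev Zq : Type := MvPolynomial ℕ ℤ

/-- The variable `q_i`. -/
def q (i : ℕ) : Zq := X i

/-- The polynomial
`F_p^k = ∑_{I ⊆ [k], |I| = p} ∏_{i ∈ I} (1 - x_i) ∏_{i ∈ I, i + 1 ∉ I} (1 - q_i)`. -/
def quantumF (k p : ℕ) : MvPolynomial ℕ Zq :=
  ∑ I ∈ powersetCard p (Icc 1 k), (∏ i ∈ I, (1 - X i)) * ∏ i ∈ I with i + 1 ∉ I, C (1 - q i)

/-- The polynomial `Ê_p^k = ∑_{i=0}^p (-1)^i binom(k-i, p-i) F_i^k`, used for `0 ≤ p ≤ k`. -/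
def quantumE (k p : ℕ) : MvPolynomial ℕ Zq :=
  ∑ i ∈ range (p + 1), (-1) ^ i * ((k - i).choose (p - i) : MvPolynomial ℕ Zq) * quantumF k i

/-- The `K`-theoretic quantization map: the `ℤ[q]`-linear map on `L_n^q = ℤ[q] ⊗ L_n` which sends
`e_{p_1 … p_{n-1}}` to `Ê_{p_1 … p_{n-1}} = Ê_{p_1}^1 ⋯ Ê_{p_{n-1}}^{n-1}`. -/
def quantization (n : ℕ) : stairModule Zq n →ₗ[Zq] MvPolynomial ℕ Zq :=
  (stdBasis Zq n).constr Zq fun p => ∏ k : Fin n, quantumE k (p k)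

/-- The quantum Grothendieck polynomial `𝔊^q_w`, the image of `𝔊_w` under the quantization
map. -/
def quantumGrothendieck {n : ℕ} (w : Equiv.Perm (Fin n)) : MvPolynomial ℕ Zq :=
  quantization n ⟨grothendieck Zq w, grothendieck_mem_stairModule Zq w⟩

/-- The quantum double Grothendieck polynomial of the longest element,
`∏_{i=1}^{n-1} (1 + ∑_{j=1}^i (-1)^j (1 - x_{n-i})^j F_j^i(y))`.  It lies in `ℤ[q][y][x]`: the
variables `x` are the outer ones, the coefficient ring is `ℤ[q][y]`. -/
def quantumDoubleLongest (n : ℕ) : MvPolynomial ℕ (MvPolynomial ℕ Zq) :=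
  ∏ i ∈ Icc 1 (n - 1), (1 + ∑ j ∈ Icc 1 i, (-1) ^ j * (1 - X (n - i)) ^ j * C (quantumF i j))

/-- The quantum double Grothendieck polynomial
`𝔊^q_w(x, y) = π^{(x)}_{w⁻¹ w_∘} 𝔊^q_{w_∘}(x, y)` in `ℤ[q][y][x]`. -/
def quantumDoubleGrothendieck {n : ℕ} (w : Equiv.Perm (Fin n)) :
    MvPolynomial ℕ (MvPolynomial ℕ Zq) :=
  isobaricPerm (w⁻¹ * longest n) (quantumDoubleLongest n)

theorem quantumDoubleGrothendieck_longest (n : ℕ) :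
    quantumDoubleGrothendieck (longest n) = quantumDoubleLongest n := by
  have h : reducedWord (1 : Equiv.Perm (Fin n)) = [] :=
    List.length_eq_zero_iff.1 (Nat.le_zero.1
      ((Classical.choose_spec (exists_isReducedWord (1 : Equiv.Perm (Fin n)))).2 [] rfl))
  rw [quantumDoubleGrothendieck, inv_mul_cancel, isobaricPerm, h, List.foldr_nil]

end Quantum

end QuantumGrothendieck

end

/-! The identity is the image of a classical one under quantization in `y`. Put `P = ∏_{a+b≤n} (x_a
+ y_b - x_a y_b)`. Two expansions of `P` are compared.

First, `P = ∑_w ℌ_w(x) 𝔊_{ww_∘}(y)` (`cauchyProduct_eq_sum`). Both sides lie in the staircase module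
in `x`, have the same constant term in `x`, namely `𝔊_{w_∘}(y)`, and are carried by `π_i` in `x` to
the same result as by `π_{n-i}` in `y`. For `P` this holds because all factors but one form a
product symmetric in both pairs of variables. For the sum it follows from the recursions: `π_i 𝔊_w`
is `𝔊_{ws_i}` at a descent and `𝔊_w` at an ascent, while `π_i ℌ_w` is `ℌ_w + ℌ_{ws_i}` at a descent
and `0` at an ascent. The first recursion rests on the braid relations and Matsumoto's theorem, the
second on the lifting property of the Bruhat order. The difference then vanishes
(`eq_zero_of_coeff_isobaric`): its lowest homogeneous part in `x` is symmetric in `x_1, …, x_n`, and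
a symmetric element of the staircase module is constant.

Second, the factors with `a = n - k` multiply to `∑_p x_a^{k-p} (1-x_a)^p e_p^k(y)`, so `P` is a
combination of standard elementary monomials in `y` (`cauchyProduct_eq_sum_elem`).

Quantization is linear, so it may be applied to the `y`-coefficients of both expansions
(`sum_map_mul_C_congr`). The first becomes the right side of the theorem. In the second, `e_p^k`
becomes `Ê_p^k`, and the binomial theorem collapses each factor to that of `𝔊^q_{w_∘}(x, y)`
(`sum_quantumE`). -/

noncomputable section

namespace QuantumGrothendieck

open MvPolynomial Finset

/-! ### Lengths and reduced words -/

section Length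

variable {n : ℕ}

/-- The smaller of the two positions exchanged by `simple i`. -/
def lo (i : Fin (n - 1)) : Fin n := ⟨i, by omega⟩

/-- The larger of the two positions exchanged by `simple i`. -/
def hi (i : Fin (n - 1)) : Fin n := ⟨i + 1, by omega⟩

@[simp] theorem lo_val (i : Fin (n - 1)) : ((lo i : Fin n) : ℕ) = i := rfl

@[simp] theorem hi_val (i : Fin (n - 1)) : ((hi i : Fin n) : ℕ) = i + 1 := rfl

theorem lo_lt_hi (i : Fin (n - 1)) : lo i < hi i := by simp [Fin.lt_def]

theorem simple_eq (i : Fin (n - 1)) : simple i = Equiv.swap (lo i) (hi i) := rfl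

@[simp] theorem simple_lo (i : Fin (n - 1)) : simple i (lo i) = hi i := Equiv.swap_apply_left _ _

@[simp] theorem simple_hi (i : Fin (n - 1)) : simple i (hi i) = lo i := Equiv.swap_apply_right _ _

@[simp] theorem simple_simple (i : Fin (n - 1)) (p : Fin n) : simple i (simple i p) = p :=
  Equiv.swap_apply_self _ _ _

@[simp] theorem simple_mul_self (i : Fin (n - 1)) : simple i * simple i = 1 :=
  Equiv.swap_mul_self _ _

@[simp] theorem mul_simple_simple (w : Equiv.Perm (Fin n)) (i : Fin (n - 1)) :
    w * simple i * simple i = w := by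
  rw [mul_assoc, simple_mul_self, mul_one]

@[simp] theorem simple_inv (i : Fin (n - 1)) : (simple i)⁻¹ = simple i := Equiv.swap_inv _ _

theorem simple_apply_of_ne {i : Fin (n - 1)} {p : Fin n} (h1 : (p : ℕ) ≠ i)
    (h2 : (p : ℕ) ≠ i + 1) : simple i p = p :=
  Equiv.swap_apply_of_ne_of_ne (fun h => h1 (congrArg Fin.val h))
    (fun h => h2 (congrArg Fin.val h))

theorem simple_apply_lt_iff (i : Fin (n - 1)) {p r : Fin n} (h : ¬ (p = lo i ∧ r = hi i))
    (h' : ¬ (p = hi i ∧ r = lo i)) : simple i p < simple i r ↔ p < r := by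
  simp only [simple_eq, Equiv.swap_apply_def]
  simp only [Fin.ext_iff, lo_val, hi_val, Fin.lt_def] at *
  split_ifs <;> simp only [lo_val, hi_val] <;> omega

/-- Moving positions by `s_i` carries the inversions of `w` to those of `w s_i`, except that the
pair `(lo i, hi i)` becomes a new one. -/
theorem length_mul_simple {w : Equiv.Perm (Fin n)} {i : Fin (n - 1)} (h : w (lo i) < w (hi i)) :
    length (w * simple i) = length w + 1 := by
  have key : ({p : Fin n × Fin n | p.1 < p.2 ∧ (w * simple i) p.2 < (w * simple i) p.1} :
      Finset (Fin n × Fin n)) = insert (lo i, hi i)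
      (({p : Fin n × Fin n | p.1 < p.2 ∧ w p.2 < w p.1} : Finset (Fin n × Fin n)).map
        ((simple i).prodCongr (simple i)).toEmbedding) := by
    ext ⟨p, r⟩
    have hs : ((simple i).prodCongr (simple i)).symm (p, r) = (simple i p, simple i r) := rfl
    rw [mem_filter, mem_insert, Finset.mem_map_equiv, hs, mem_filter]
    simp only [mem_univ, true_and, Equiv.Perm.mul_apply]
    by_cases h1 : p = lo i ∧ r = hi i
    · obtain ⟨rfl, rfl⟩ := h1
      simp [h, lo_lt_hi]
    by_cases h2 : p = hi i ∧ r = lo i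
    · obtain ⟨rfl, rfl⟩ := h2
      simp [h.le, (lo_lt_hi i).ne]
    · rw [simple_apply_lt_iff i h1 h2]
      simp only [Prod.mk.injEq, h1, false_or]
  unfold length
  rw [key, Finset.card_insert_of_notMem, Finset.card_map]
  intro hmem
  rw [Finset.mem_map_equiv] at hmem
  have hs : ((simple i).prodCongr (simple i)).symm (lo i, hi i) = (hi i, lo i) := by
    change (simple i (lo i), simple i (hi i)) = _
    simp
  rw [hs] at hmem
  exact absurd (mem_filter.1 hmem).2.1 (lo_lt_hi i).not_gt

theorem length_mul_simple_of_gt {w : Equiv.Perm (Fin n)} {i : Fin (n - 1)}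
    (h : w (hi i) < w (lo i)) : length (w * simple i) + 1 = length w := by
  have := length_mul_simple (w := w * simple i) (i := i) (by simpa using h)
  rwa [mul_simple_simple, eq_comm] at this

theorem apply_lo_ne_apply_hi (w : Equiv.Perm (Fin n)) (i : Fin (n - 1)) : w (lo i) ≠ w (hi i) :=
  fun h => (lo_lt_hi i).ne (w.injective h)

theorem length_inv (w : Equiv.Perm (Fin n)) : length w⁻¹ = length w := by
  unfold length
  refine Finset.card_bij' (fun p _ => (w⁻¹ p.2, w⁻¹ p.1)) (fun p _ => (w p.2, w p.1)) ?_ ?_ ?_ ?_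
  all_goals simp +contextual

@[simp] theorem length_one : length (1 : Equiv.Perm (Fin n)) = 0 := by
  unfold length
  rw [Finset.card_eq_zero, Finset.filter_eq_empty_iff]
  rintro ⟨p, r⟩ _ ⟨h1, h2⟩
  exact absurd h1 h2.not_gt

theorem length_mul_simple_le (w : Equiv.Perm (Fin n)) (i : Fin (n - 1)) :
    length (w * simple i) ≤ length w + 1 := by
  rcases (apply_lo_ne_apply_hi w i).lt_or_gt with h | h
  · exact (length_mul_simple h).le
  · have := length_mul_simple_of_gt h
    omega

theorem length_simple_mul_le (w : Equiv.Perm (Fin n)) (i : Fin (n - 1)) :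
    length (simple i * w) ≤ length w + 1 := by
  rw [← length_inv, ← length_inv w, mul_inv_rev, simple_inv]
  exact length_mul_simple_le _ _

theorem length_simple_mul_of_gt {w : Equiv.Perm (Fin n)} {i : Fin (n - 1)}
    (h : w⁻¹ (hi i) < w⁻¹ (lo i)) : length (simple i * w) + 1 = length w := by
  rw [← length_inv, ← length_inv w, mul_inv_rev, simple_inv]
  exact length_mul_simple_of_gt h

theorem length_simple_mul {w : Equiv.Perm (Fin n)} {i : Fin (n - 1)}
    (h : w⁻¹ (lo i) < w⁻¹ (hi i)) : length (simple i * w) = length w + 1 := by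
  rw [← length_inv, ← length_inv w, mul_inv_rev, simple_inv]
  exact length_mul_simple h

theorem eq_one_of_forall_lt {w : Equiv.Perm (Fin n)}
    (h : ∀ i : Fin (n - 1), w (lo i) < w (hi i)) : w = 1 := by
  refine perm_eq_one_of_le w ?_
  rintro ⟨k, hk⟩
  induction k with
  | zero => exact Fin.le_def.2 (Nat.zero_le _)
  | succ k ih =>
    have h1 := Fin.le_def.1 (ih (by omega))
    have h2 := Fin.lt_def.1 (h ⟨k, by omega⟩)
    simp only [lo, hi] at h1 h2
    exact Fin.le_def.2 (by simp only; omega)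

theorem exists_gt_of_ne_one {w : Equiv.Perm (Fin n)} (hw : w ≠ 1) :
    ∃ i : Fin (n - 1), w (hi i) < w (lo i) := by
  by_contra! h
  exact hw (eq_one_of_forall_lt fun i => (h i).lt_of_ne (apply_lo_ne_apply_hi w i))

theorem eq_one_of_length_eq_zero {w : Equiv.Perm (Fin n)} (hw : length w = 0) : w = 1 := by
  by_contra h
  obtain ⟨i, hi⟩ := exists_gt_of_ne_one h
  have := length_mul_simple_of_gt hi
  omega

theorem length_prod_le (l : List (Fin (n - 1))) : length (l.map simple).prod ≤ l.length := by
  induction l with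
  | nil => simp
  | cons i l ih =>
    rw [List.map_cons, List.prod_cons, List.length_cons]
    exact (length_simple_mul_le _ _).trans (by omega)

theorem exists_word_length (w : Equiv.Perm (Fin n)) :
    ∃ l : List (Fin (n - 1)), (l.map simple).prod = w ∧ l.length = length w := by
  induction h : length w generalizing w with
  | zero => exact ⟨[], (eq_one_of_length_eq_zero h).symm, rfl⟩
  | succ N ih =>
    have hne : w⁻¹ ≠ 1 := by
      rintro h1
      rw [inv_eq_one.1 h1, length_one] at h
      omega
    obtain ⟨i, hi⟩ := exists_gt_of_ne_one hne
    have h1 := length_simple_mul_of_gt hi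
    obtain ⟨l, hl, hN⟩ := ih (simple i * w) (by omega)
    refine ⟨i :: l, ?_, by simp [hN]⟩
    rw [List.map_cons, List.prod_cons, hl, ← mul_assoc, simple_mul_self, one_mul]

theorem reducedWord_prod (w : Equiv.Perm (Fin n)) : ((reducedWord w).map simple).prod = w :=
  (Classical.choose_spec (exists_isReducedWord w)).1

/-- Reduced words are defined by minimality, `length` by inversions. They agree since one letter
changes the inversion number by at most one, and stripping left descents reaches the identity in
exactly `length w` steps. -/
theorem reducedWord_length (w : Equiv.Perm (Fin n)) : (reducedWord w).length = length w := by
  refine le_antisymm ?_ ?_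
  · obtain ⟨l, hl, h⟩ := exists_word_length w
    exact h ▸ (Classical.choose_spec (exists_isReducedWord w)).2 l hl
  · conv_lhs => rw [← reducedWord_prod w]
    exact length_prod_le _

theorem swap_mul_swap_mul_swap_eq {α : Type*} [DecidableEq α] {a b c : α} (ha : b ≠ a)
    (hc : b ≠ c) : Equiv.swap a c * Equiv.swap c b * Equiv.swap a c = Equiv.swap a b := by
  have := Equiv.swap_apply_apply (Equiv.swap a c) c b
  rw [Equiv.swap_apply_right, Equiv.swap_apply_of_ne_of_ne ha hc, Equiv.swap_inv] at this
  exact this.symm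

theorem simple_comm {i j : Fin (n - 1)} (h : (i : ℕ) + 1 < j) :
    simple i * simple j = simple j * simple i := by
  refine (Equiv.Perm.disjoint_swap_swap ?_).commute
  simp [Fin.ext_iff]
  omega

theorem simple_braid {i j : Fin (n - 1)} (h : (i : ℕ) + 1 = j) :
    simple i * simple j * simple i = simple j * simple i * simple j := by
  have hij : hi i = lo j := Fin.ext h
  have h1 : lo i ≠ lo j := by simp [Fin.ext_iff]; omega
  have h2 : lo i ≠ hi j := by simp [Fin.ext_iff]; omega
  have h3 := (lo_lt_hi j).ne
  have e1 := swap_mul_swap_mul_swap_eq (a := lo i) (c := lo j) h2.symm h3.symm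
  have e2 := swap_mul_swap_mul_swap_eq (a := hi j) (c := lo j) h2 h1
  rw [simple_eq, simple_eq, hij, e1, Equiv.swap_comm (lo j) (hi j), Equiv.swap_comm (lo i) (lo j),
    e2, Equiv.swap_comm]

end Length

/-! ### Matsumoto's theorem for the symmetric group -/

section Matsumoto

variable {n : ℕ} {E : Type*} [Monoid E]

theorem length_eq_of_cons {i : Fin (n - 1)} {t : List (Fin (n - 1))} {w : Equiv.Perm (Fin n)} {N : ℕ}
    (hp : ((i :: t).map simple).prod = w) (hl : (i :: t).length = N + 1) (hw : length w = N + 1) :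
    (t.map simple).prod = simple i * w ∧ length (simple i * w) = N ∧
      w⁻¹ (hi i) < w⁻¹ (lo i) := by
  have h1 : (t.map simple).prod = simple i * w := by
    rw [← hp, List.map_cons, List.prod_cons, ← mul_assoc, simple_mul_self, one_mul]
  have h2 : length (simple i * w) ≤ N := by
    rw [← h1]
    exact (length_prod_le t).trans (by simpa using hl.le)
  rcases (apply_lo_ne_apply_hi w⁻¹ i).lt_or_gt with h | h
  · have := length_simple_mul h
    omega
  · have := length_simple_mul_of_gt h
    exact ⟨h1, by omega, h⟩

/-- Induction on length. If two reduced words start with different letters `i` and `j`, both are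
left descents, so `w` also has reduced words starting with the two forms of the longest element of
`⟨s_i, s_j⟩` and ending alike. Each given word agrees with one of these by induction after its first
letter, and the commutation or braid relation joins the two. -/
theorem prod_map_eq_of_reduced (T : Fin (n - 1) → E)
    (hcomm : ∀ i j : Fin (n - 1), (i : ℕ) + 1 < j → T i * T j = T j * T i)
    (hbraid : ∀ i j : Fin (n - 1), (i : ℕ) + 1 = j → T i * T j * T i = T j * T i * T j)
    (l l' : List (Fin (n - 1))) (w : Equiv.Perm (Fin n))
    (hl : (l.map simple).prod = w) (hl' : (l'.map simple).prod = w)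
    (hN : l.length = length w) (hN' : l'.length = length w) :
    (l.map T).prod = (l'.map T).prod := by
  induction h : length w using Nat.strong_induction_on generalizing w l l' with
  | _ N ih =>
  rcases N with _ | N
  · rw [h, List.length_eq_zero_iff] at hN hN'
    rw [hN, hN']
  rw [h] at hN hN'
  have aux : ∀ (i j : Fin (n - 1)) (t t' : List (Fin (n - 1))), (i : ℕ) < j →
      ((i :: t).map simple).prod = w → ((j :: t').map simple).prod = w →
      (i :: t).length = N + 1 → (j :: t').length = N + 1 →
      ((i :: t).map T).prod = ((j :: t').map T).prod := by
    intro i j t t' hij ht ht' hlt hlt'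
    obtain ⟨h1, h2, h3⟩ := length_eq_of_cons ht hlt h
    obtain ⟨h1', h2', h3'⟩ := length_eq_of_cons ht' hlt' h
    have hlt : t.length = N := by simpa using hlt
    have hlt' : t'.length = N := by simpa using hlt'
    rw [List.map_cons, List.prod_cons, List.map_cons, List.prod_cons]
    rcases Nat.lt_or_ge (i + 1) j with hj | hj
    · have h4 : length (simple j * (simple i * w)) + 1 = length (simple i * w) := by
        refine length_simple_mul_of_gt ?_
        rw [mul_inv_rev, simple_inv, Equiv.Perm.mul_apply, Equiv.Perm.mul_apply,
          simple_apply_of_ne (by simp; omega) (by simp; omega),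
          simple_apply_of_ne (by simp; omega) (by simp; omega)]
        exact h3'
      obtain ⟨m, hm, hm'⟩ := exists_word_length (simple j * (simple i * w))
      have e1 : (t.map T).prod = ((j :: m).map T).prod := by
        refine ih N (by omega) t (j :: m) _ h1 ?_ (by omega) (by rw [List.length_cons]; omega) h2
        rw [List.map_cons, List.prod_cons, hm, ← mul_assoc, simple_mul_self, one_mul]
      have e2 : (t'.map T).prod = ((i :: m).map T).prod := by
        refine ih N (by omega) t' (i :: m) _ h1' ?_ (by omega) (by rw [List.length_cons]; omega) h2'
        rw [List.map_cons, List.prod_cons, hm, ← mul_assoc (simple j), ← simple_comm hj, mul_assoc,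
          ← mul_assoc, simple_mul_self, one_mul]
      rw [e1, e2, List.map_cons, List.prod_cons, List.map_cons, List.prod_cons, ← mul_assoc,
        ← mul_assoc, hcomm i j hj]
    · have hj : (i : ℕ) + 1 = j := by omega
      have hij' : hi i = lo j := Fin.ext hj
      have e3 : simple i (hi j) = hi j := simple_apply_of_ne (by simp; omega) (by simp; omega)
      have e4 : simple j (lo i) = lo i := simple_apply_of_ne (by simp; omega) (by simp; omega)
      have h4 : length (simple j * (simple i * w)) + 1 = length (simple i * w) := by
        refine length_simple_mul_of_gt ?_
        rw [mul_inv_rev, simple_inv, Equiv.Perm.mul_apply, Equiv.Perm.mul_apply, e3, ← hij',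
          simple_hi]
        exact h3'.trans (hij' ▸ h3)
      have h5 : length (simple i * (simple j * (simple i * w))) + 1 =
          length (simple j * (simple i * w)) := by
        refine length_simple_mul_of_gt ?_
        simp only [mul_inv_rev, simple_inv, Equiv.Perm.mul_apply]
        rw [e4, simple_lo, hij', simple_lo, e3]
        exact h3'
      obtain ⟨m, hm, hm'⟩ := exists_word_length (simple i * (simple j * (simple i * w)))
      have e1 : (t.map T).prod = ((j :: i :: m).map T).prod := by
        refine ih N (by omega) t (j :: i :: m) _ h1 ?_ (by omega)
          (by simp only [List.length_cons]; omega) h2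
        simp only [List.map_cons, List.prod_cons]
        rw [hm, ← mul_assoc (simple i), simple_mul_self, one_mul, ← mul_assoc, simple_mul_self,
          one_mul]
      have e2 : (t'.map T).prod = ((i :: j :: m).map T).prod := by
        refine ih N (by omega) t' (i :: j :: m) _ h1' ?_ (by omega)
          (by simp only [List.length_cons]; omega) h2'
        simp only [List.map_cons, List.prod_cons]
        rw [hm]
        have : simple i * (simple j * (simple i * (simple j * (simple i * w)))) =
          simple i * simple j * simple i * simple j * simple i * w := by simp only [mul_assoc]
        rw [this, simple_braid hj]
        simp
      rw [e1, e2]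
      simp only [List.map_cons, List.prod_cons, ← mul_assoc]
      rw [hbraid i j hj]
  rcases l with _ | ⟨i, t⟩
  · simp at hN
  rcases l' with _ | ⟨j, t'⟩
  · simp at hN'
  rcases lt_trichotomy (i : ℕ) j with hij | hij | hij
  · exact aux i j t t' hij hl hl' hN hN'
  · obtain rfl : i = j := Fin.ext hij
    obtain ⟨h1, h2, -⟩ := length_eq_of_cons hl hN h
    obtain ⟨h1', -, -⟩ := length_eq_of_cons hl' hN' h
    have hN : t.length = N := by simpa using hN
    have hN' : t'.length = N := by simpa using hN'
    rw [List.map_cons, List.prod_cons, List.map_cons, List.prod_cons,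
      ih N (by omega) t t' _ h1 h1' (by omega) (by omega) h2]
  · exact (aux j i t' t hij hl' hl hN' hN).symm

end Matsumoto

/-! ### The lifting property of the Bruhat order -/

section Bruhat

variable {n : ℕ}

/-- Induction on `b - a` through `t_{ab} = s_a t_{a+1,b} s_a`. The middle factor raises the length.
The outer ones change it by one each, and when the first lowers it the last raises it. -/
theorem length_lt_length_mul_swap (w : Equiv.Perm (Fin n)) {b a : Fin n} (hab : a < b)
    (h : w a < w b) : length w < length (w * Equiv.swap a b) := by
  obtain ⟨d, hd⟩ : ∃ d, (b : ℕ) = a + 1 + d := ⟨b - (a + 1), by rw [Fin.lt_def] at hab; omega⟩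
  induction d generalizing w a with
  | zero =>
    let i : Fin (n - 1) := ⟨a, by omega⟩
    have hb : b = hi i := Fin.ext (by simpa using hd)
    rw [hb] at h ⊢
    have : length (w * simple i) = length w + 1 := length_mul_simple h
    change _ < length (w * simple i)
    omega
  | succ d ih =>
    let i : Fin (n - 1) := ⟨a, by omega⟩
    have hlo : a = lo i := rfl
    have hcb : hi i < b := by rw [Fin.lt_def, hi_val]; change (a : ℕ) + 1 < b; omega
    have ha : a ≠ hi i := by rw [hlo]; exact (lo_lt_hi i).ne
    have hconj : Equiv.swap a b = simple i * Equiv.swap (hi i) b * simple i :=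
      (swap_mul_swap_mul_swap_eq hab.ne' hcb.ne').symm
    have h2 := ih (w * simple i) (a := hi i) hcb
      (by
        rw [Equiv.Perm.mul_apply, Equiv.Perm.mul_apply, simple_hi, simple_apply_of_ne]
        · exact h
        · change (b : ℕ) ≠ a; omega
        · change (b : ℕ) ≠ a + 1; omega) (by rw [hi_val]; change (b : ℕ) = a + 1 + 1 + d; omega)
    rw [hconj, ← mul_assoc, ← mul_assoc]
    set v := w * simple i * Equiv.swap (hi i) b with hv
    have hb : simple i b = b := by
      refine simple_apply_of_ne ?_ ?_
      · change (b : ℕ) ≠ a; omega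
      · change (b : ℕ) ≠ a + 1; omega
    have hva : v (lo i) = w (hi i) := by
      rw [hv, Equiv.Perm.mul_apply, Equiv.swap_apply_of_ne_of_ne (lo_lt_hi i).ne (hlo ▸ hab.ne)]
      simp
    have hvc : v (hi i) = w b := by
      rw [hv, Equiv.Perm.mul_apply, Equiv.swap_apply_left, Equiv.Perm.mul_apply, hb]
    rcases (apply_lo_ne_apply_hi w i).lt_or_gt with h3 | h3
    · have h4 := length_mul_simple h3
      rcases (apply_lo_ne_apply_hi v i).lt_or_gt with h5 | h5
      · have := length_mul_simple h5
        omega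
      · have := length_mul_simple_of_gt h5
        omega
    · have h4 := length_mul_simple_of_gt h3
      have := length_mul_simple (w := v) (i := i)
        (by rw [hva, hvc]; exact h3.trans (hlo ▸ h))
      omega

/-- Two elements related by a cover in the Bruhat order. -/
def BruhatCover (u v : Equiv.Perm (Fin n)) : Prop :=
  ∃ a b : Fin n, v = u * Equiv.swap a b ∧ length v = length u + 1

theorem BruhatLE.of_cover {u v : Equiv.Perm (Fin n)} (h : BruhatCover u v) : BruhatLE u v :=
  Relation.ReflTransGen.single h

theorem BruhatLE.trans {u v w : Equiv.Perm (Fin n)} (h : BruhatLE u v) (h' : BruhatLE v w) :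
    BruhatLE u w :=
  Relation.ReflTransGen.trans h h'

theorem BruhatLE.length_le {u v : Equiv.Perm (Fin n)} (h : BruhatLE u v) :
    length u ≤ length v := by
  induction h with
  | refl => exact le_rfl
  | tail _ h ih =>
    obtain ⟨_, _, _, h⟩ := h
    omega

theorem bruhatLE_mul_simple {u : Equiv.Perm (Fin n)} {i : Fin (n - 1)}
    (h : u (lo i) < u (hi i)) : BruhatLE u (u * simple i) :=
  .of_cover ⟨lo i, hi i, rfl, length_mul_simple h⟩

theorem mul_simple_bruhatLE {u : Equiv.Perm (Fin n)} {i : Fin (n - 1)}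
    (h : u (hi i) < u (lo i)) : BruhatLE (u * simple i) u :=
  .of_cover ⟨lo i, hi i, by rw [← simple_eq, mul_simple_simple], (length_mul_simple_of_gt h).symm⟩

theorem BruhatCover.exists_lt {u v : Equiv.Perm (Fin n)} (h : BruhatCover u v) :
    ∃ a b : Fin n, a < b ∧ u a < u b ∧ v = u * Equiv.swap a b := by
  obtain ⟨a, b, rfl, hl⟩ := h
  have key : ∀ a b : Fin n, a < b → length (u * Equiv.swap a b) = length u + 1 → u a < u b := by
    intro a b hab hl
    by_contra hlt
    have h1 := length_lt_length_mul_swap (u * Equiv.swap a b) hab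
      (by
        simp only [Equiv.Perm.mul_apply, Equiv.swap_apply_left, Equiv.swap_apply_right]
        exact (not_lt.1 hlt).lt_of_ne fun h => hab.ne (u.injective h).symm)
    rw [mul_assoc, Equiv.swap_mul_self, mul_one] at h1
    omega
  rcases lt_trichotomy a b with hab | rfl | hab
  · exact ⟨a, b, hab, key a b hab hl, rfl⟩
  · rw [Equiv.swap_self] at hl
    exact absurd hl (Nat.lt_succ_self _).ne
  · rw [Equiv.swap_comm] at hl ⊢
    exact ⟨b, a, hab, key b a hab hl, rfl⟩

/-- Since `t_{ab} = t_{ac} t_{cb} t_{ac}` and each of the three factors would raise the length, the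
total rise would be at least three. -/
theorem not_between_of_cover {u : Equiv.Perm (Fin n)} {a b c : Fin n}
    (hl : length (u * Equiv.swap a b) = length u + 1) (hac : a < c) (hcb : c < b)
    (h1 : u a < u c) (h2 : u c < u b) : False := by
  have e1 := length_lt_length_mul_swap u hac h1
  have e2 := length_lt_length_mul_swap (u * Equiv.swap a c) hcb (by
    rw [Equiv.Perm.mul_apply, Equiv.Perm.mul_apply, Equiv.swap_apply_right,
      Equiv.swap_apply_of_ne_of_ne (hac.trans hcb).ne' hcb.ne']
    exact h1.trans h2)
  have e3 := length_lt_length_mul_swap (u * Equiv.swap a c * Equiv.swap c b) hac (by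
    simp only [Equiv.Perm.mul_apply]
    rw [Equiv.swap_apply_left, Equiv.swap_apply_of_ne_of_ne hac.ne (hac.trans hcb).ne,
      Equiv.swap_apply_left, Equiv.swap_apply_of_ne_of_ne (hac.trans hcb).ne' hcb.ne']
    exact h2)
  have : u * Equiv.swap a c * Equiv.swap c b * Equiv.swap a c = u * Equiv.swap a b := by
    rw [mul_assoc, mul_assoc, ← mul_assoc (Equiv.swap a c),
      swap_mul_swap_mul_swap_eq (hac.trans hcb).ne' hcb.ne']
  rw [this] at e3
  omega

/-- If `u` and `v` both ascend or both descend at `i`, the cover survives multiplication by `s_i`.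
If `u` descends and `v` ascends, then `u s_i ≤ u ≤ v ≤ v s_i`. An ascent of `u` that becomes a
descent of `v` forces the exchanged positions to be exactly those of `s_i`. -/
theorem BruhatCover.eq_or_le {u v : Equiv.Perm (Fin n)} (h : BruhatCover u v) (i : Fin (n - 1)) :
    v = u * simple i ∨ BruhatLE (u * simple i) (v * simple i) := by
  obtain ⟨a, b, hab, huab, rfl⟩ := h.exists_lt
  obtain ⟨_, _, _, hl⟩ := h
  have hcov : length (u * Equiv.swap a b * simple i) = length (u * simple i) + 1 →
      BruhatLE (u * simple i) (u * Equiv.swap a b * simple i) := by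
    intro hl'
    refine .of_cover ⟨simple i a, simple i b, ?_, hl'⟩
    rw [Equiv.swap_apply_apply]
    simp only [simple_inv, ← mul_assoc, mul_simple_simple]
  rcases (apply_lo_ne_apply_hi u i).lt_or_gt with h1 | h1 <;>
  rcases (apply_lo_ne_apply_hi (u * Equiv.swap a b) i).lt_or_gt with h2 | h2
  · right
    have h3 := length_mul_simple h1
    have h4 := length_mul_simple h2
    exact hcov (by omega)
  · left
    rw [simple_eq]
    simp only [Equiv.Perm.mul_apply] at h2
    by_cases ha1 : lo i = a
    · by_cases hb2 : hi i = b
      · rw [ha1, hb2]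
      · have ha2 : hi i ≠ a := fun h => (lo_lt_hi i).ne (ha1.trans h.symm)
        rw [ha1, Equiv.swap_apply_left, Equiv.swap_apply_of_ne_of_ne ha2 hb2] at h2
        rw [ha1] at h1
        refine (not_between_of_cover hl (ha1 ▸ lo_lt_hi i) ?_ h1 h2).elim
        rw [Fin.ext_iff, lo_val] at ha1
        rw [Fin.ext_iff, hi_val] at hb2
        rw [Fin.lt_def] at hab ⊢
        rw [hi_val]
        omega
    · by_cases hb1 : lo i = b
      · have ha2 : hi i ≠ a := fun h => by
          have := lo_lt_hi i
          rw [h, hb1] at this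
          exact this.not_gt hab
        have hb2 : hi i ≠ b := fun h => (lo_lt_hi i).ne (hb1.trans h.symm)
        rw [hb1, Equiv.swap_apply_right, Equiv.swap_apply_of_ne_of_ne ha2 hb2] at h2
        rw [hb1] at h1
        exact absurd (h2.trans huab) h1.not_gt
      · rw [Equiv.swap_apply_of_ne_of_ne ha1 hb1] at h2
        by_cases ha2 : hi i = a
        · rw [ha2, Equiv.swap_apply_left] at h2
          rw [ha2] at h1
          exact absurd (h1.trans huab) h2.not_gt
        · by_cases hb2 : hi i = b
          · rw [hb2, Equiv.swap_apply_right] at h2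
            rw [hb2] at h1
            refine (not_between_of_cover hl ?_ (hb2 ▸ lo_lt_hi i) h2 h1).elim
            rw [Fin.ext_iff, hi_val] at hb2
            rw [Fin.ext_iff, lo_val] at ha1
            rw [Fin.lt_def] at hab ⊢
            rw [lo_val]
            omega
          · rw [Equiv.swap_apply_of_ne_of_ne ha2 hb2] at h2
            exact absurd h1 h2.not_gt
  · right
    exact (mul_simple_bruhatLE h1).trans
      ((BruhatLE.of_cover ⟨a, b, rfl, hl⟩).trans (bruhatLE_mul_simple h2))
  · right
    have h3 := length_mul_simple_of_gt h1
    have h4 := length_mul_simple_of_gt h2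
    exact hcov (by omega)

/-- One half of the lifting property, by running `BruhatCover.eq_or_le` along a chain;
`BruhatLE.mul_simple_right` is the other half. -/
theorem BruhatLE.mul_simple_left {u v : Equiv.Perm (Fin n)} (h : BruhatLE u v) {i : Fin (n - 1)}
    (hv : v (hi i) < v (lo i)) : BruhatLE (u * simple i) v := by
  induction h using Relation.ReflTransGen.head_induction_on with
  | refl => exact mul_simple_bruhatLE hv
  | head h h' ih =>
    rcases BruhatCover.eq_or_le h i with e | e
    · rw [← e]
      exact h'
    · exact e.trans ih

theorem BruhatLE.mul_simple_right {u v : Equiv.Perm (Fin n)} (h : BruhatLE u v) {i : Fin (n - 1)}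
    (hu : u (lo i) < u (hi i)) : BruhatLE u (v * simple i) := by
  induction h with
  | refl => exact bruhatLE_mul_simple hu
  | tail h h' ih =>
    rcases BruhatCover.eq_or_le h' i with e | e
    · rw [e, mul_simple_simple]
      exact h
    · exact ih.trans e

end Bruhat

/-! ### Properties of the divided difference operators -/

section Operators

variable {R : Type*} [CommRing R]

theorem swapVars_X (i k : ℕ) : swapVars i (X k : MvPolynomial ℕ R) = X (Equiv.swap i (i + 1) k) :=
  rename_X _ _

@[simp] theorem swapVars_X_left (i : ℕ) : swapVars i (X i : MvPolynomial ℕ R) = X (i + 1) := by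
  rw [swapVars_X, Equiv.swap_apply_left]

@[simp] theorem swapVars_X_right (i : ℕ) : swapVars i (X (i + 1) : MvPolynomial ℕ R) = X i := by
  rw [swapVars_X, Equiv.swap_apply_right]

theorem swapVars_X_of_ne {i k : ℕ} (h : k ≠ i) (h' : k ≠ i + 1) :
    swapVars i (X k : MvPolynomial ℕ R) = X k := by
  rw [swapVars_X, Equiv.swap_apply_of_ne_of_ne h h']

theorem swapVars_swapVars (i : ℕ) (f : MvPolynomial ℕ R) : swapVars i (swapVars i f) = f := by
  rw [swapVars, rename_rename, ← Equiv.Perm.coe_mul, Equiv.swap_mul_self]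
  exact rename_id_apply f

theorem swapVars_comm {i j : ℕ} (h : i + 1 < j) (f : MvPolynomial ℕ R) :
    swapVars i (swapVars j f) = swapVars j (swapVars i f) := by
  simp only [swapVars, rename_rename, ← Equiv.Perm.coe_mul]
  have hd : Equiv.Perm.Disjoint (Equiv.swap i (i + 1)) (Equiv.swap j (j + 1)) :=
    Equiv.Perm.disjoint_swap_swap (by simp; omega)
  rw [hd.commute.eq]

theorem swapVars_braid (i : ℕ) (f : MvPolynomial ℕ R) :
    swapVars i (swapVars (i + 1) (swapVars i f)) =
      swapVars (i + 1) (swapVars i (swapVars (i + 1) f)) := by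
  simp only [swapVars, rename_rename, ← Equiv.Perm.coe_mul, ← mul_assoc]
  have e1 := swap_mul_swap_mul_swap_eq (a := i) (b := i + 1 + 1) (c := i + 1) (by omega) (by omega)
  have e2 := swap_mul_swap_mul_swap_eq (a := i + 1 + 1) (b := i) (c := i + 1) (by omega) (by omega)
  rw [e1, Equiv.swap_comm (i + 1) (i + 1 + 1), Equiv.swap_comm i (i + 1), e2, Equiv.swap_comm]

theorem swapVars_map {S : Type*} [CommRing S] (φ : R →+* S) (i : ℕ) (f : MvPolynomial ℕ R) :
    swapVars i (map φ f) = map φ (swapVars i f) :=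
  (map_rename φ _ f).symm

/-- The denominator-free form of `π_i`. Over a domain it determines `π_i f` (`eq_isobaric`), so
operator identities reduce to verifying it. -/
theorem isobaric_spec (i : ℕ) (f : MvPolynomial ℕ R) :
    (X i - X (i + 1)) * isobaric i f = (1 - X (i + 1)) * f - (1 - X i) * swapVars i f := by
  rw [isobaric]
  linear_combination -(1 - X i) * divDiff_spec i f

variable [IsDomain R]

theorem X_sub_X_ne_zero {i j : ℕ} (h : i ≠ j) : (X i - X j : MvPolynomial ℕ R) ≠ 0 :=
  sub_ne_zero.2 fun e => h (X_injective e)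

theorem eq_isobaric {i : ℕ} {f g : MvPolynomial ℕ R}
    (h : (X i - X (i + 1)) * g = (1 - X (i + 1)) * f - (1 - X i) * swapVars i f) :
    g = isobaric i f :=
  mul_left_cancel₀ (X_sub_X_ne_zero (Nat.succ_ne_self i).symm) (h.trans (isobaric_spec i f).symm)

theorem isobaric_add (i : ℕ) (f g : MvPolynomial ℕ R) :
    isobaric i (f + g) = isobaric i f + isobaric i g := by
  refine (eq_isobaric ?_).symm
  rw [map_add]
  linear_combination isobaric_spec i f + isobaric_spec i g

theorem isobaric_mul_of_swapVars {i : ℕ} {g : MvPolynomial ℕ R} (hg : swapVars i g = g)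
    (f : MvPolynomial ℕ R) : isobaric i (g * f) = g * isobaric i f := by
  refine (eq_isobaric ?_).symm
  rw [map_mul, hg]
  linear_combination g * isobaric_spec i f

/-- The operator `π_i` as a linear map. -/
def isobaricLin (R : Type*) [CommRing R] [IsDomain R] (i : ℕ) :
    MvPolynomial ℕ R →ₗ[R] MvPolynomial ℕ R where
  toFun := isobaric i
  map_add' := isobaric_add i
  map_smul' c f := by
    rw [smul_eq_C_mul, isobaric_mul_of_swapVars (algHom_C _ _), RingHom.id_apply, smul_eq_C_mul]

@[simp] theorem isobaricLin_apply (i : ℕ) (f : MvPolynomial ℕ R) :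
    isobaricLin R i f = isobaric i f := rfl

theorem swapVars_isobaric (i : ℕ) (f : MvPolynomial ℕ R) :
    swapVars i (isobaric i f) = isobaric i f := by
  refine eq_isobaric ?_
  have := congrArg (swapVars i) (isobaric_spec i f)
  simp only [map_mul, map_sub, map_one, swapVars_X_left, swapVars_X_right,
    swapVars_swapVars] at this
  linear_combination -this

theorem swapVars_eq_of_isobaric {i : ℕ} {f : MvPolynomial ℕ R} (h : isobaric i f = f) :
    swapVars i f = f := by
  rw [← h, swapVars_isobaric]

theorem isobaric_isobaric (i : ℕ) (f : MvPolynomial ℕ R) :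
    isobaric i (isobaric i f) = isobaric i f := by
  refine (eq_isobaric ?_).symm
  rw [swapVars_isobaric]
  ring

theorem isobaric_comm {i j : ℕ} (h : i + 1 < j) (f : MvPolynomial ℕ R) :
    isobaric i (isobaric j f) = isobaric j (isobaric i f) := by
  have h1 := isobaric_spec i (isobaric j f)
  have h2 := isobaric_spec j f
  have h3 := congrArg (swapVars i) h2
  have h1' := isobaric_spec j (isobaric i f)
  have h2' := isobaric_spec i f
  have h3' := congrArg (swapVars j) h2'
  have e1 : swapVars i (X j : MvPolynomial ℕ R) = X j := swapVars_X_of_ne (by omega) (by omega)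
  have e2 : swapVars i (X (j + 1) : MvPolynomial ℕ R) = X (j + 1) :=
    swapVars_X_of_ne (by omega) (by omega)
  have e3 : swapVars j (X i : MvPolynomial ℕ R) = X i := swapVars_X_of_ne (by omega) (by omega)
  have e4 : swapVars j (X (i + 1) : MvPolynomial ℕ R) = X (i + 1) :=
    swapVars_X_of_ne (by omega) (by omega)
  simp only [map_mul, map_sub, map_one, e1, e2, e3, e4, swapVars_comm h] at h3 h3'
  refine mul_left_cancel₀ (mul_ne_zero (X_sub_X_ne_zero (R := R) (Nat.succ_ne_self i).symm)
    (X_sub_X_ne_zero (R := R) (Nat.succ_ne_self j).symm)) ?_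
  linear_combination (X j - X (j + 1)) * h1 + (1 - X (i + 1)) * h2 - (1 - X i) * h3
    - (X i - X (i + 1)) * h1' - (1 - X (j + 1)) * h2' + (1 - X j) * h3'

theorem isobaric_braid (i : ℕ) (f : MvPolynomial ℕ R) :
    isobaric i (isobaric (i + 1) (isobaric i f)) =
      isobaric (i + 1) (isobaric i (isobaric (i + 1) f)) := by
  have hc : swapVars i (X (i + 1 + 1) : MvPolynomial ℕ R) = X (i + 1 + 1) :=
    swapVars_X_of_ne (by omega) (by omega)
  have ha : swapVars (i + 1) (X i : MvPolynomial ℕ R) = X i :=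
    swapVars_X_of_ne (by omega) (by omega)
  have k1 := isobaric_spec i (isobaric (i + 1) (isobaric i f))
  have h1 := isobaric_spec (i + 1) (isobaric i f)
  have sh1 := congrArg (swapVars i) h1
  have g1 := isobaric_spec i f
  have sg1 := congrArg (swapVars (i + 1)) g1
  have ssg1 := congrArg (swapVars i) sg1
  have k2 := isobaric_spec (i + 1) (isobaric i (isobaric (i + 1) f))
  have h2 := isobaric_spec i (isobaric (i + 1) f)
  have sh2 := congrArg (swapVars (i + 1)) h2
  have g2 := isobaric_spec (i + 1) f
  have sg2 := congrArg (swapVars i) g2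
  have ssg2 := congrArg (swapVars (i + 1)) sg2
  simp only [map_mul, map_sub, map_one, swapVars_X_left, swapVars_X_right, ha, hc,
    swapVars_isobaric] at sh1 sg1 ssg1 sh2 sg2 ssg2
  have hb := swapVars_braid i f
  have n1 := X_sub_X_ne_zero (R := R) (Nat.succ_ne_self i).symm
  have n2 := X_sub_X_ne_zero (R := R) (Nat.succ_ne_self (i + 1)).symm
  have n3 := X_sub_X_ne_zero (R := R) (i := i) (j := i + 1 + 1) (by omega)
  generalize isobaric i (isobaric (i + 1) (isobaric i f)) = u at *
  generalize isobaric (i + 1) (isobaric i (isobaric (i + 1) f)) = v at *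
  generalize (X i : MvPolynomial ℕ R) = a at *
  generalize (X (i + 1) : MvPolynomial ℕ R) = b at *
  generalize (X (i + 1 + 1) : MvPolynomial ℕ R) = c at *
  -- The Vandermonde factor `(a-b)(b-c)(a-c)` does not suffice: expanding the left side meets the
  -- denominator `a-b` twice, and the right side `b-c` twice. After clearing, both sides are the
  -- same combination of the permuted copies of `f`, with `hb` identifying the two forms of the
  -- longest one.
  refine mul_left_cancel₀ (mul_ne_zero (mul_ne_zero (mul_ne_zero n1 n2) n3)
    (mul_ne_zero n1 n2)) ?_
  linear_combination
    (b - c) * ((a - b) * (b - c) * (a - c) * k1 + (a - b) * (a - c) * (1 - b) * h1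
      - (a - b) * (b - c) * (1 - a) * sh1
      + ((a - c) * (1 - b) * (1 - c) - (b - c) * (1 - a) * (1 - c)) * g1
      - (a - b) * (1 - b) ^ 2 * sg1 + (a - b) * (1 - a) ^ 2 * ssg1)
    - (a - b) * ((a - b) * (b - c) * (a - c) * k2 + (a - c) * (b - c) * (1 - c) * h2
      - (a - b) * (b - c) * (1 - b) * sh2
      + ((a - c) * (1 - c) * (1 - b) - (a - b) * (1 - b) * (1 - c)) * g2
      - (b - c) * (1 - c) * (1 - a) * sg2 + (b - c) * (1 - b) * (1 - a) * ssg2)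
    - (a - b) * (b - c) * (1 - a) ^ 2 * (1 - b) * hb

theorem isobaricPerm_eq_prod {n : ℕ} (w : Equiv.Perm (Fin n)) (f : MvPolynomial ℕ R) :
    isobaricPerm w f = ((reducedWord w).map
      fun i : Fin (n - 1) => (isobaricLin R ((i : ℕ) + 1) : Module.End R (MvPolynomial ℕ R))).prod f := by
  unfold isobaricPerm
  induction reducedWord w with
  | nil => rfl
  | cons i l ih => rw [List.foldr_cons, ih, List.map_cons, List.prod_cons]; rfl

/-- Matsumoto's theorem applied to the operators `π_i`: it frees `isobaricPerm` from the chosen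
reduced word. -/
theorem isobaric_isobaricPerm {n : ℕ} {w : Equiv.Perm (Fin n)} {i : Fin (n - 1)}
    (h : length (simple i * w) = length w + 1) (f : MvPolynomial ℕ R) :
    isobaric ((i : ℕ) + 1) (isobaricPerm w f) = isobaricPerm (simple i * w) f := by
  rw [isobaricPerm_eq_prod, isobaricPerm_eq_prod]
  have := prod_map_eq_of_reduced
    (fun i : Fin (n - 1) => (isobaricLin R ((i : ℕ) + 1) : Module.End R (MvPolynomial ℕ R)))
    (fun i j hij => LinearMap.ext fun f => isobaric_comm (by omega) f)
    (fun i j hij => LinearMap.ext fun f => by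
      obtain ⟨j, hj⟩ := j
      subst hij
      exact isobaric_braid (i + 1) f)
    (i :: reducedWord w) (reducedWord (simple i * w)) (simple i * w)
    (by rw [List.map_cons, List.prod_cons, reducedWord_prod]) (reducedWord_prod _)
    (by rw [List.length_cons, reducedWord_length, h]) (reducedWord_length _)
  rw [← this, List.map_cons, List.prod_cons]
  rfl

end Operators

theorem isobaric_map {R S : Type*} [CommRing R] [CommRing S] [IsDomain S] (φ : R →+* S) (i : ℕ)
    (f : MvPolynomial ℕ R) : isobaric i (map φ f) = map φ (isobaric i f) := by
  refine (eq_isobaric ?_).symm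
  have := congrArg (map φ) (isobaric_spec i f)
  simpa [swapVars_map] using this

/-! ### Coefficients of polynomials in the staircase module -/

section Coefficients

variable {R : Type*} [CommRing R]

theorem coeff_swapVars (i : ℕ) (m : ℕ →₀ ℕ) (f : MvPolynomial ℕ R) :
    coeff (m.mapDomain (Equiv.swap i (i + 1))) (swapVars i f) = coeff m f :=
  coeff_rename_mapDomain _ (Equiv.injective _) _ _

theorem mapDomain_swap_mapDomain_swap (i : ℕ) (m : ℕ →₀ ℕ) :
    (m.mapDomain (Equiv.swap i (i + 1))).mapDomain (Equiv.swap i (i + 1)) = m := by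
  rw [← Finsupp.mapDomain_comp, ← Equiv.Perm.coe_mul, Equiv.swap_mul_self]
  exact Finsupp.mapDomain_id

theorem coeff_swapVars' (i : ℕ) (m : ℕ →₀ ℕ) (f : MvPolynomial ℕ R) :
    coeff m (swapVars i f) = coeff (m.mapDomain (Equiv.swap i (i + 1))) f := by
  rw [← coeff_swapVars i (m.mapDomain _), mapDomain_swap_mapDomain_swap]

theorem mem_stairExponents_of_coeff_ne_zero {n : ℕ} {f : MvPolynomial ℕ R}
    (hf : f ∈ stairModule R n) {m : ℕ →₀ ℕ} (hm : coeff m f ≠ 0) : m ∈ stairExponents n := by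
  rw [stairModule_eq, mem_restrictSupport_iff] at hf
  exact hf (mem_support_iff.2 hm)

/-- An element of the staircase module whose degree `d` coefficients are symmetric in
`x_1, …, x_n` has no nonzero coefficient of degree `d`, except possibly the constant term. -/
theorem eq_zero_of_coeff_ne_zero_of_symm {n d : ℕ} {f : MvPolynomial ℕ R}
    (hf : f ∈ stairModule R n)
    (hsym : ∀ i, 1 ≤ i → i + 1 ≤ n → ∀ m : ℕ →₀ ℕ, m.degree = d →
      coeff (m.mapDomain (Equiv.swap i (i + 1))) f = coeff m f)
    {m : ℕ →₀ ℕ} (hd : m.degree = d) (hm : coeff m f ≠ 0) : m = 0 := by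
  -- The exponent of `x_n` is at most `n - n = 0`. Symmetry moves the exponent of `x_{n-k-1}` to
  -- `x_{n-k}`, where it is already known to vanish. When the truncated index reaches `0`, the
  -- unused variable `x_0` is excluded by definition.
  have key : ∀ k, ∀ m : ℕ →₀ ℕ, m.degree = d → coeff m f ≠ 0 → m (n - k) = 0 := by
    intro k
    induction k with
    | zero =>
      intro m _ hm
      have := (mem_stairExponents_of_coeff_ne_zero hf hm).2 n
      rw [Nat.sub_zero]
      omega
    | succ k ih =>
      intro m hd hm
      rcases Nat.eq_zero_or_pos (n - (k + 1)) with h0 | h0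
      · rw [h0]
        exact (mem_stairExponents_of_coeff_ne_zero hf hm).1
      have h1 := ih (m.mapDomain (Equiv.swap (n - (k + 1)) (n - (k + 1) + 1)))
        (by rw [Finsupp.degree_mapDomain, hd]) (by rwa [hsym _ h0 (by omega) m hd])
      have h2 : n - k = Equiv.swap (n - (k + 1)) (n - (k + 1) + 1) (n - (k + 1)) := by
        rw [Equiv.swap_apply_left]
        omega
      rwa [h2, Finsupp.mapDomain_apply (Equiv.injective _)] at h1
  ext j
  rcases Nat.le_total j n with hj | hj
  · have := key (n - j) m hd hm
    rwa [Nat.sub_sub_self hj] at this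
  · have := (mem_stairExponents_of_coeff_ne_zero hf hm).2 j
    simp only [Finsupp.coe_zero, Pi.zero_apply]
    omega

end Coefficients

/-! ### Orders of vanishing at the origin -/

section Order

variable {R : Type*} [CommRing R]

theorem le_order_swapVars {i N : ℕ} {f : MvPolynomial ℕ R}
    (hf : (N : ℕ∞) ≤ (f : MvPowerSeries ℕ R).order) :
    (N : ℕ∞) ≤ (swapVars i f : MvPowerSeries ℕ R).order := by
  refine MvPowerSeries.nat_le_order fun m hm => ?_
  rw [coeff_coe, coeff_swapVars', ← coeff_coe]
  refine MvPowerSeries.coeff_of_lt_order (lt_of_lt_of_le ?_ hf)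
  rw [Finsupp.degree_mapDomain]
  exact_mod_cast hm

/-- Over a domain orders add under multiplication and `x_i - x_{i+1}` has order at most one, so
`∂_i` loses at most one. -/
theorem le_order_isobaric [IsDomain R] {i N : ℕ} {f : MvPolynomial ℕ R}
    (hf : ((N + 1 : ℕ) : ℕ∞) ≤ (f : MvPowerSeries ℕ R).order) :
    (N : ℕ∞) ≤ (isobaric i f : MvPowerSeries ℕ R).order := by
  have h1 : ((X i - X (i + 1) : MvPolynomial ℕ R) : MvPowerSeries ℕ R).order ≤ 1 := by
    refine (MvPowerSeries.order_le (d := Finsupp.single i 1) ?_).trans (by simp)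
    rw [coeff_coe]
    simp [coeff_X, Finsupp.single_left_inj]
  have h2 : ((N + 1 : ℕ) : ℕ∞) ≤ ((f - swapVars i f : MvPolynomial ℕ R) : MvPowerSeries ℕ R).order := by
    refine MvPowerSeries.nat_le_order fun m hm => ?_
    rw [coeff_coe, coeff_sub, ← coeff_coe, ← coeff_coe,
      MvPowerSeries.coeff_of_lt_order (lt_of_lt_of_le (by exact_mod_cast hm) hf),
      MvPowerSeries.coeff_of_lt_order (lt_of_lt_of_le (by exact_mod_cast hm)
        (le_order_swapVars hf)), sub_zero]
  have h3 : (N : ℕ∞) ≤ (divDiff i f : MvPowerSeries ℕ R).order := by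
    rw [divDiff_spec, MvPolynomial.coe_mul, MvPowerSeries.order_mul] at h2
    have h4 := h2.trans (add_le_add_left h1 _)
    rw [Nat.cast_add, Nat.cast_one, add_comm] at h4
    exact (ENat.add_le_add_iff_left (by simp)).1 h4
  rw [isobaric, MvPolynomial.coe_add]
  refine le_trans (le_min ?_ ?_) MvPowerSeries.min_order_le_add
  · exact le_trans (by exact_mod_cast Nat.le_succ N) hf
  · rw [MvPolynomial.coe_mul, MvPowerSeries.order_mul]
    exact h3.trans le_add_self

end Order

/-! ### Recursion for Grothendieck polynomials -/

section Grothendieck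

variable {R : Type*} [CommRing R] [IsDomain R] {n : ℕ}

theorem longest_apply (p : Fin n) : longest n p = Fin.rev p := rfl

theorem longest_mul_self : longest n * longest n = 1 := by
  ext p
  simp [longest]

theorem longest_inv : (longest n)⁻¹ = longest n := inv_eq_of_mul_eq_one_left longest_mul_self

/-- At a descent of `w`, the element `(w s_i)⁻¹ w_∘ = s_i (w⁻¹ w_∘)` is longer by one than `w⁻¹
w_∘`. -/
theorem isobaric_grothendieck_of_gt {w : Equiv.Perm (Fin n)} {i : Fin (n - 1)}
    (h : w (hi i) < w (lo i)) :
    isobaric ((i : ℕ) + 1) (grothendieck R w) = grothendieck R (w * simple i) := by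
  have hl : length (simple i * (w⁻¹ * longest n)) = length (w⁻¹ * longest n) + 1 := by
    refine length_simple_mul ?_
    rw [mul_inv_rev, inv_inv, longest_inv, Equiv.Perm.mul_apply, Equiv.Perm.mul_apply,
      longest_apply, longest_apply]
    exact Fin.rev_lt_rev.2 h
  rw [grothendieck, isobaric_isobaricPerm hl, grothendieck, mul_inv_rev, simple_inv, mul_assoc]

theorem isobaric_grothendieck_of_lt {w : Equiv.Perm (Fin n)} {i : Fin (n - 1)}
    (h : w (lo i) < w (hi i)) :
    isobaric ((i : ℕ) + 1) (grothendieck R w) = grothendieck R w := by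
  have := isobaric_grothendieck_of_gt (R := R) (w := w * simple i) (i := i) (by simpa using h)
  rw [mul_simple_simple] at this
  rw [← this, isobaric_isobaric]

/-! ### Constant terms of Grothendieck polynomials -/

theorem isobaricPerm_one {R : Type*} [CommRing R] (f : MvPolynomial ℕ R) :
    isobaricPerm (1 : Equiv.Perm (Fin n)) f = f := by
  have h : reducedWord (1 : Equiv.Perm (Fin n)) = [] := by
    rw [← List.length_eq_zero_iff, reducedWord_length, length_one]
  rw [isobaricPerm, h, List.foldr_nil]

theorem grothendieck_longest (R : Type*) [CommRing R] (n : ℕ) :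
    grothendieck R (longest n) = ∏ i ∈ Icc 1 (n - 1), X i ^ (n - i) := by
  rw [grothendieck, inv_mul_cancel, isobaricPerm_one]

theorem eval_one_isobaric {R : Type*} [CommRing R] (i : ℕ) (f : MvPolynomial ℕ R) :
    eval (fun _ => 1) (isobaric i f) = eval (fun _ => 1) f := by
  simp [isobaric]

theorem eval_one_grothendieck {R : Type*} [CommRing R] (w : Equiv.Perm (Fin n)) :
    eval (fun _ => 1) (grothendieck R w) = 1 := by
  unfold grothendieck isobaricPerm
  induction reducedWord (w⁻¹ * longest n) with
  | nil => simp
  | cons i l ih => rw [List.foldr_cons, eval_one_isobaric, ih]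

/-- The identity has only ascents, so `𝔊_1` is fixed by every `π_i` and is symmetric in `x_1, …,
x_n`; in the staircase module this makes it constant. The constant is read off at `x = (1, 1, …)`, a
point where `π_i` preserves values. -/
theorem grothendieck_one (R : Type*) [CommRing R] [IsDomain R] (n : ℕ) :
    grothendieck R (1 : Equiv.Perm (Fin n)) = 1 := by
  have hsym : ∀ i, 1 ≤ i → i + 1 ≤ n → ∀ m : ℕ →₀ ℕ,
      coeff (m.mapDomain (Equiv.swap i (i + 1))) (grothendieck R (1 : Equiv.Perm (Fin n))) =
        coeff m (grothendieck R (1 : Equiv.Perm (Fin n))) := by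
    intro i h1 h2 m
    obtain ⟨i, rfl⟩ : ∃ k, i = k + 1 := ⟨i - 1, by omega⟩
    rw [← coeff_swapVars']
    congr 1
    exact swapVars_eq_of_isobaric (isobaric_grothendieck_of_lt (w := 1)
      (i := (⟨i, by omega⟩ : Fin (n - 1))) (lo_lt_hi _))
  have hC : grothendieck R (1 : Equiv.Perm (Fin n)) =
      C (coeff 0 (grothendieck R (1 : Equiv.Perm (Fin n)))) := by
    ext m
    rw [coeff_C]
    split_ifs with h
    · rw [h]
    · by_contra hm
      exact h (eq_zero_of_coeff_ne_zero_of_symm (grothendieck_mem_stairModule R 1)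
        (fun i h1 h2 m _ => hsym i h1 h2 m) rfl hm).symm
  have h1 := eval_one_grothendieck (R := R) (1 : Equiv.Perm (Fin n))
  rw [hC, eval_C] at h1
  rw [hC, h1, map_one]

theorem card_pairs_eq_sum (n : ℕ) :
    #{p : Fin n × Fin n | p.1 < p.2} = ∑ i ∈ Icc 1 (n - 1), (n - i) := by
  have h1 : #{p : Fin n × Fin n | p.1 < p.2} = ∑ p : Fin n, (n - 1 - (p : ℕ)) := by
    simp only [← Fin.card_Ioi]
    rw [← Finset.card_sigma]
    refine Finset.card_bij' (fun p _ => ⟨p.1, p.2⟩) (fun p _ => (p.1, p.2)) ?_ ?_ ?_ ?_ <;> simp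
  rw [h1, Fin.sum_univ_eq_sum_range (fun p => n - 1 - p)]
  rcases n with _ | m
  · simp
  have h2 : Icc 1 (m + 1 - 1) = Ico 1 (m + 1) := by
    ext
    simp
  rw [h2, Finset.sum_Ico_eq_sum_range, Finset.sum_range_succ]
  simp only [Nat.add_sub_cancel, Nat.sub_self, add_zero]
  exact Finset.sum_congr rfl fun i _ => by omega

theorem length_inv_mul_longest_lt {w : Equiv.Perm (Fin n)} (hw : w ≠ 1) :
    length (w⁻¹ * longest n) < ∑ i ∈ Icc 1 (n - 1), (n - i) := by
  rw [← card_pairs_eq_sum]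
  obtain ⟨i, h⟩ := exists_gt_of_ne_one (inv_ne_one.2 hw)
  refine Finset.card_lt_card (Finset.ssubset_iff_of_subset ?_ |>.2
    ⟨(Fin.rev (hi i), Fin.rev (lo i)), ?_, ?_⟩)
  · intro p hp
    rw [mem_filter] at hp ⊢
    exact ⟨hp.1, hp.2.1⟩
  · simpa using lo_lt_hi i
  · intro hm
    have := (mem_filter.1 hm).2.2
    simp only [Equiv.Perm.mul_apply, longest_apply, Fin.rev_rev] at this
    exact this.not_gt h

theorem le_order_foldr_isobaric (l : List (Fin (n - 1))) (f : MvPolynomial ℕ R) {N : ℕ}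
    (hf : ((N + l.length : ℕ) : ℕ∞) ≤ (f : MvPowerSeries ℕ R).order) :
    (N : ℕ∞) ≤ ((l.foldr (fun (i : Fin (n - 1)) g => isobaric ((i : ℕ) + 1) g) f :
      MvPolynomial ℕ R) : MvPowerSeries ℕ R).order := by
  induction l generalizing N with
  | nil => simpa using hf
  | cons i l ih =>
    refine le_order_isobaric (ih ?_)
    rwa [add_assoc, add_comm 1, ← List.length_cons (a := i)]

/-- The starting monomial has degree `n(n-1)/2`, each `π_i` lowers the order by at most one, and for
`w ≠ 1` fewer than `n(n-1)/2` operators are applied. -/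
theorem coeff_zero_grothendieck {w : Equiv.Perm (Fin n)} (hw : w ≠ 1) :
    coeff 0 (grothendieck R w) = 0 := by
  have h : ((1 : ℕ) : ℕ∞) ≤ (grothendieck R w : MvPowerSeries ℕ R).order := by
    refine le_order_foldr_isobaric _ _ ?_
    rw [reducedWord_length]
    have hX : (∏ i ∈ Icc 1 (n - 1), X i ^ (n - i) : MvPolynomial ℕ R) =
        monomial (∑ i ∈ Icc 1 (n - 1), Finsupp.single i (n - i)) 1 := by
      rw [monomial_sum_one]
      exact Finset.prod_congr rfl fun i _ => X_pow_eq_monomial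
    rw [hX, coe_monomial, MvPowerSeries.order_monomial_of_ne_zero one_ne_zero, map_sum]
    simp only [Finsupp.degree_single]
    have := length_inv_mul_longest_lt hw
    exact_mod_cast (by omega : 1 + length (w⁻¹ * longest n) ≤ ∑ i ∈ Icc 1 (n - 1), (n - i))
  rw [← coeff_coe]
  exact MvPowerSeries.coeff_of_lt_order (lt_of_lt_of_le (by simp) h)

theorem map_isobaricPerm {R S : Type*} [CommRing R] [CommRing S] [IsDomain S] (φ : R →+* S)
    (w : Equiv.Perm (Fin n)) (f : MvPolynomial ℕ R) :
    map φ (isobaricPerm w f) = isobaricPerm w (map φ f) := by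
  unfold isobaricPerm
  induction reducedWord w with
  | nil => rfl
  | cons i l ih => rw [List.foldr_cons, List.foldr_cons, ← ih, isobaric_map]

theorem map_grothendieck {R S : Type*} [CommRing R] [CommRing S] [IsDomain S] (φ : R →+* S)
    (w : Equiv.Perm (Fin n)) : map φ (grothendieck R w) = grothendieck S w := by
  rw [grothendieck, map_isobaricPerm, grothendieck]
  simp [map_prod]

end Grothendieck

/-! ### Recursion for dual Grothendieck polynomials -/

section Dual

variable {R : Type*} [CommRing R] {n : ℕ}

-- The exponent `ℓ(v) - ℓ(w)` is a truncated difference, but `w ≤ v` gives `ℓ(w) ≤ ℓ(v)`. With the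
-- sign of `w` factored out and the sum taken over all of `S_n`, sign-reversing involutions apply.
open Classical in
theorem dualGrothendieck_eq (R : Type*) [CommRing R] (w : Equiv.Perm (Fin n)) :
    dualGrothendieck R w = (-1) ^ length w *
      ∑ v : Equiv.Perm (Fin n), if BruhatLE w v then (-1) ^ length v * grothendieck R v else 0 := by
  rw [dualGrothendieck, Finset.sum_filter, Finset.mul_sum]
  refine Finset.sum_congr rfl fun v _ => ?_
  split_ifs with h
  · obtain ⟨d, hd⟩ := Nat.exists_eq_add_of_le h.length_le
    rw [hd, Nat.add_sub_cancel_left, ← mul_assoc, ← pow_add,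
      (by ring : length w + (length w + d) = 2 * length w + d), pow_add, pow_mul]
    simp
  · simp

variable [IsDomain R]

theorem dualGrothendieck_mem_stairModule (R : Type*) [CommRing R] [IsDomain R]
    (w : Equiv.Perm (Fin n)) : dualGrothendieck R w ∈ stairModule R n := by
  refine Submodule.sum_mem _ fun v _ => ?_
  rcases neg_one_pow_eq_or (MvPolynomial ℕ R) (length v - length w) with h | h
  · rw [h, one_mul]
    exact grothendieck_mem_stairModule R v
  · rw [h, neg_one_mul]
    exact Submodule.neg_mem _ (grothendieck_mem_stairModule R v)

theorem map_dualGrothendieck {R S : Type*} [CommRing R] [CommRing S] [IsDomain S] (φ : R →+* S)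
    (w : Equiv.Perm (Fin n)) : map φ (dualGrothendieck R w) = dualGrothendieck S w := by
  simp [dualGrothendieck, map_grothendieck]

theorem coeff_zero_dualGrothendieck (w : Equiv.Perm (Fin n)) :
    coeff 0 (dualGrothendieck R w) = if w = 1 then 1 else 0 := by
  classical
  have h0 : coeff 0 (dualGrothendieck R w) = (-1) ^ length w *
      ∑ v : Equiv.Perm (Fin n), if BruhatLE w v then (-1) ^ length v * coeff 0 (grothendieck R v)
        else 0 := by
    rw [dualGrothendieck_eq]
    simp only [← constantCoeff_eq, map_mul, map_sum, map_pow, map_neg, map_one, apply_ite, map_zero]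
  rw [h0, Finset.sum_eq_single 1]
  · rw [grothendieck_one]
    split_ifs with h1 h2 h2
    · simp [h2]
    · exact absurd (eq_one_of_length_eq_zero (Nat.le_zero.1 (by simpa using h1.length_le))) h2
    · exact absurd (h2 ▸ Relation.ReflTransGen.refl) h1
    · simp
  · intro v _ hv
    rw [coeff_zero_grothendieck hv]
    simp
  · simp

theorem isobaric_sum_ite {ι : Type*} [Fintype ι] (i : ℕ) (p : ι → Prop) [DecidablePred p]
    (a : ι → ℕ) (g : ι → MvPolynomial ℕ R) (c : ℕ) :
    isobaric i ((-1) ^ c * ∑ v, if p v then (-1) ^ a v * g v else 0) =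
      (-1) ^ c * ∑ v, if p v then (-1) ^ a v * isobaric i (g v) else 0 := by
  have hs : ∀ k : ℕ, swapVars i ((-1 : MvPolynomial ℕ R) ^ k) = (-1) ^ k := by simp
  rw [isobaric_mul_of_swapVars (hs c), ← isobaricLin_apply, map_sum]
  congr 1
  refine Finset.sum_congr rfl fun v _ => ?_
  split_ifs
  · rw [isobaricLin_apply, isobaric_mul_of_swapVars (hs _)]
  · rw [map_zero]

theorem BruhatLE.mul_simple_iff {w v : Equiv.Perm (Fin n)} {i : Fin (n - 1)}
    (hw : w (lo i) < w (hi i)) : BruhatLE w (v * simple i) ↔ BruhatLE w v :=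
  ⟨fun h => mul_simple_simple v i ▸ h.mul_simple_right hw, fun h => h.mul_simple_right hw⟩

theorem mul_simple_ne_self (w : Equiv.Perm (Fin n)) (i : Fin (n - 1)) : w * simple i ≠ w := by
  intro h
  have := congrArg (fun u : Equiv.Perm (Fin n) => u (hi i)) h
  simp only [Equiv.Perm.mul_apply, simple_hi] at this
  exact apply_lo_ne_apply_hi w i this

/-- By lifting, the upper interval of `w` is stable under `v ↦ v s_i`. The polynomials of `v` and `v
s_i` have the same image under `π_i` and enter with opposite signs. -/
theorem isobaric_dualGrothendieck_of_lt {w : Equiv.Perm (Fin n)} {i : Fin (n - 1)}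
    (h : w (lo i) < w (hi i)) : isobaric ((i : ℕ) + 1) (dualGrothendieck R w) = 0 := by
  classical
  rw [dualGrothendieck_eq, isobaric_sum_ite]
  refine mul_eq_zero_of_right _ (Finset.sum_involution (fun v _ => v * simple i) ?_ ?_ ?_ ?_)
  · intro v _
    rw [BruhatLE.mul_simple_iff h]
    split_ifs
    · rcases (apply_lo_ne_apply_hi v i).lt_or_gt with h1 | h1
      · rw [isobaric_grothendieck_of_lt h1, isobaric_grothendieck_of_gt (by simpa using h1),
          length_mul_simple h1, mul_simple_simple]
        ring
      · rw [isobaric_grothendieck_of_gt h1, isobaric_grothendieck_of_lt (by simpa using h1),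
          ← length_mul_simple_of_gt h1]
        ring
    · simp
  · intro v _ _
    exact mul_simple_ne_self v i
  · simp
  · simp

theorem isobaric_dualGrothendieck_of_gt {w : Equiv.Perm (Fin n)} {i : Fin (n - 1)}
    (h : w (hi i) < w (lo i)) :
    isobaric ((i : ℕ) + 1) (dualGrothendieck R w) =
      dualGrothendieck R w + dualGrothendieck R (w * simple i) := by
  classical
  have hw' : (w * simple i) (lo i) < (w * simple i) (hi i) := by simpa using h
  have hle : ∀ v : Equiv.Perm (Fin n), v (hi i) < v (lo i) →
      (BruhatLE w v ↔ BruhatLE (w * simple i) v) := by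
    refine fun v hv => ⟨fun h1 => (mul_simple_bruhatLE h).trans h1, fun h1 => ?_⟩
    have := h1.mul_simple_left hv
    rwa [mul_simple_simple] at this
  -- Up to sign, the sum of `F` is `π_i ℌ_w - ℌ_w - ℌ_{ws_i}`. It cancels in pairs `v, v s_i`: on
  -- descents `v` the conditions `w ≤ v` and `w s_i ≤ v` coincide, and on ascents `π_i` fixes `𝔊_v`.
  let F : Equiv.Perm (Fin n) → MvPolynomial ℕ R := fun v =>
    (if BruhatLE w v then (-1) ^ length v * isobaric ((i : ℕ) + 1) (grothendieck R v) else 0) -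
      (if BruhatLE w v then (-1) ^ length v * grothendieck R v else 0) +
      if BruhatLE (w * simple i) v then (-1) ^ length v * grothendieck R v else 0
  have hpair : ∀ v : Equiv.Perm (Fin n), v (hi i) < v (lo i) → F v + F (v * simple i) = 0 := by
    intro v hv
    have hv' : (v * simple i) (lo i) < (v * simple i) (hi i) := by simpa using hv
    simp only [F]
    rw [BruhatLE.mul_simple_iff hw', hle v hv, isobaric_grothendieck_of_gt hv,
      isobaric_grothendieck_of_lt hv', ← length_mul_simple_of_gt hv]
    split_ifs <;> ring
  have hF : ∑ v, F v = 0 := by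
    refine Finset.sum_involution (fun v _ => v * simple i) ?_ ?_ ?_ ?_
    · intro v _
      rcases (apply_lo_ne_apply_hi v i).lt_or_gt with h1 | h1
      · have := hpair (v * simple i) (by simpa using h1)
        rwa [mul_simple_simple, add_comm] at this
      · exact hpair v h1
    · intro v _ _
      exact mul_simple_ne_self v i
    · simp
    · simp
  simp only [F] at hF
  rw [Finset.sum_add_distrib, Finset.sum_sub_distrib] at hF
  rw [dualGrothendieck_eq, isobaric_sum_ite, dualGrothendieck_eq R (w * simple i),
    ← length_mul_simple_of_gt h, pow_succ]
  linear_combination -(-1) ^ length (w * simple i) * hF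

end Dual

/-! ### The Cauchy identity for Grothendieck polynomials -/

section Cauchy

/-- A polynomial in the staircase module without constant term vanishes as soon as each `π_i` acts
on it through its coefficients. -/
theorem eq_zero_of_coeff_isobaric {B : Type*} [CommRing B] {n : ℕ} {D : MvPolynomial ℕ B}
    (hD : D ∈ stairModule B n) (h0 : coeff 0 D = 0)
    (h : ∀ i : Fin (n - 1), ∃ T : B → B, T 0 = 0 ∧
      ∀ m, coeff m (isobaric ((i : ℕ) + 1) D) = T (coeff m D)) : D = 0 := by
  have key : ∀ d, ∀ m : ℕ →₀ ℕ, m.degree = d → coeff m D = 0 := by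
    intro d
    induction d using Nat.strong_induction_on with
    | _ d ih =>
    intro m hm
    by_contra hne
    refine hne ?_
    rw [eq_zero_of_coeff_ne_zero_of_symm hD ?_ hm hne, h0]
    clear hne hm m
    intro i h1 h2 m hm
    obtain ⟨i, rfl⟩ : ∃ k, i = k + 1 := ⟨i - 1, by omega⟩
    obtain ⟨T, hT0, hT⟩ := h ⟨i, by omega⟩
    simp only at hT
    have hlow : ∀ (r : ℕ) (s : ℕ →₀ ℕ), s.degree = d → ∀ f : MvPolynomial ℕ B,
        (∀ t : ℕ →₀ ℕ, t.degree < d → coeff t f = 0) → coeff s (X r * f) = 0 := by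
      intro r s hs f hf
      rw [coeff_X_mul']
      split_ifs with hr
      · refine hf _ ?_
        have h3 : s - Finsupp.single r 1 + Finsupp.single r 1 = s := by
          refine tsub_add_cancel_of_le ?_
          rw [Finsupp.single_le_iff]
          exact Nat.one_le_iff_ne_zero.2 (Finsupp.mem_support_iff.1 hr)
        have h4 := congrArg Finsupp.degree h3
        rw [map_add, Finsupp.degree_single] at h4
        omega
      · rfl
    -- In degree `d` every term multiplied by a variable involves only lower coefficients, which
    -- vanish for `D`, for `s_i D`, and through `T 0 = 0` for `π_i D`. What remains is that `D` and
    -- `s_i D` agree in degree `d`.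
    have hspec := congrArg (coeff m) (isobaric_spec (i + 1) D)
    have hDlow : ∀ t : ℕ →₀ ℕ, t.degree < d → coeff t D = 0 := fun t ht => ih _ ht t rfl
    have hplow : ∀ t : ℕ →₀ ℕ, t.degree < d → coeff t (isobaric (i + 1) D) = 0 := fun t ht => by
      rw [hT, hDlow t ht, hT0]
    have hslow : ∀ t : ℕ →₀ ℕ, t.degree < d → coeff t (swapVars (i + 1) D) = 0 := fun t ht => by
      rw [coeff_swapVars', hDlow _ (by rwa [Finsupp.degree_mapDomain])]
    simp only [sub_mul, one_mul, coeff_sub] at hspec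
    rw [hlow _ m hm _ hplow, hlow _ m hm _ hplow, hlow _ m hm _ hDlow, hlow _ m hm _ hslow] at hspec
    rw [← coeff_swapVars']
    linear_combination hspec
  ext m
  rw [key _ m rfl, coeff_zero]

/-! ### The product side of the Cauchy identity -/

variable (K : Type*) [CommRing K] (n : ℕ)

/-- The pairs `(a, b)` of positive integers with `a + b ≤ n`. -/
def stairPairs : Finset (ℕ × ℕ) := {p ∈ Icc 1 (n - 1) ×ˢ Icc 1 (n - 1) | p.1 + p.2 ≤ n}

theorem mem_stairPairs {n : ℕ} {p : ℕ × ℕ} :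
    p ∈ stairPairs n ↔ 1 ≤ p.1 ∧ 1 ≤ p.2 ∧ p.1 + p.2 ≤ n := by
  simp only [stairPairs, mem_filter, mem_product, mem_Icc]
  omega

/-- The polynomial `x_a + y_b - x_a y_b`. -/
def cauchyFactor (p : ℕ × ℕ) : MvPolynomial ℕ (MvPolynomial ℕ K) :=
  X p.1 * C (1 - X p.2) + C (X p.2)

/-- The product of the polynomials `x_a + y_b - x_a y_b` with `a + b ≤ n`. -/
def cauchyProduct : MvPolynomial ℕ (MvPolynomial ℕ K) := ∏ p ∈ stairPairs n, cauchyFactor K p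

theorem prod_stairPairs {M : Type*} [CommMonoid M] (f : ℕ × ℕ → M) :
    ∏ p ∈ stairPairs n, f p = ∏ a ∈ Icc 1 (n - 1), ∏ b ∈ Icc 1 (n - a), f (a, b) :=
  Finset.prod_finset_product _ _ _ fun p => by
    rw [mem_stairPairs, mem_Icc, mem_Icc]
    omega

theorem prod_stairPairs_right {M : Type*} [CommMonoid M] (f : ℕ × ℕ → M) :
    ∏ p ∈ stairPairs n, f p = ∏ b ∈ Icc 1 (n - 1), ∏ a ∈ Icc 1 (n - b), f (a, b) :=
  Finset.prod_finset_product_right _ _ _ fun p => by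
    rw [mem_stairPairs, mem_Icc, mem_Icc]
    omega

theorem coeff_zero_cauchyProduct :
    coeff 0 (cauchyProduct K n) = grothendieck K (longest n) := by
  rw [← constantCoeff_eq, cauchyProduct, map_prod, prod_stairPairs_right, grothendieck_longest]
  refine Finset.prod_congr rfl fun b _ => ?_
  simp [cauchyFactor]

theorem cauchyProduct_mem_stairModule [IsDomain K] :
    cauchyProduct K n ∈ stairModule (MvPolynomial ℕ K) n := by
  have hfac : ∀ j a b : ℕ, degreeOf j (cauchyFactor K (a, b)) ≤ if a = j then 1 else 0 := by
    intro j a b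
    refine (degreeOf_add_le _ _ _).trans (max_le ?_ (by simp))
    refine (degreeOf_mul_le _ _ _).trans ?_
    rw [degreeOf_C, add_zero, degreeOf_X]
    simp [eq_comm]
  have h : ∀ j, degreeOf j (cauchyProduct K n) ≤ if j ∈ Icc 1 (n - 1) then n - j else 0 := by
    intro j
    rw [cauchyProduct, prod_stairPairs]
    refine (degreeOf_prod_le _ _ _).trans ((Finset.sum_le_sum fun a _ =>
      (degreeOf_prod_le _ _ _).trans (Finset.sum_le_sum fun b _ => hfac j a b)).trans ?_)
    simp only [Finset.sum_const, Nat.card_Icc, Nat.add_sub_cancel, smul_eq_mul, mul_ite, mul_one,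
      mul_zero, Finset.sum_ite_eq', le_refl]
  rw [mem_stairModule_iff]
  refine ⟨by simpa using h 0, fun j => (h j).trans ?_⟩
  split_ifs <;> simp

theorem swapVars_cauchyFactor (i : ℕ) (p : ℕ × ℕ) :
    swapVars i (cauchyFactor K p) = cauchyFactor K (Equiv.swap i (i + 1) p.1, p.2) := by
  simp only [cauchyFactor, map_add, map_mul, swapVars_X]
  rw [swapVars, rename_C, rename_C]

theorem map_swapVars_cauchyFactor (j : ℕ) (p : ℕ × ℕ) :
    map (swapVars j : MvPolynomial ℕ K →ₐ[K] MvPolynomial ℕ K).toRingHom (cauchyFactor K p) =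
      cauchyFactor K (p.1, Equiv.swap j (j + 1) p.2) := by
  simp [cauchyFactor, swapVars_X]

variable {K n}

theorem isobaric_one (i : ℕ) [IsDomain K] : isobaric i (1 : MvPolynomial ℕ K) = 1 :=
  (eq_isobaric (by rw [map_one]; ring)).symm

theorem isobaric_X (i : ℕ) [IsDomain K] : isobaric i (X i : MvPolynomial ℕ K) = 1 :=
  (eq_isobaric (by rw [swapVars_X_left]; ring)).symm

/-- Removing the corner factor `(i, j)` from the staircase leaves a product symmetric in `x_i,
x_{i+1}` and in `y_j, y_{j+1}`. Both operators send the corner factor to `1`, so both give the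
remaining product. -/
theorem coeff_isobaric_cauchyProduct [IsDomain K] {i j : ℕ} (hi : 1 ≤ i) (hj : 1 ≤ j)
    (hij : i + j = n) (m : ℕ →₀ ℕ) :
    coeff m (isobaric i (cauchyProduct K n)) = isobaric j (coeff m (cauchyProduct K n)) := by
  set Q : MvPolynomial ℕ (MvPolynomial ℕ K) := ∏ p ∈ (stairPairs n).erase (i, j), cauchyFactor K p
    with hQ
  have hP : cauchyProduct K n = Q * cauchyFactor K (i, j) :=
    (Finset.prod_erase_mul _ _ (mem_stairPairs.2 ⟨hi, hj, hij.le⟩)).symm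
  have hx : swapVars i Q = Q := by
    rw [hQ, map_prod]
    refine Finset.prod_nbij' (fun p => (Equiv.swap i (i + 1) p.1, p.2))
      (fun p => (Equiv.swap i (i + 1) p.1, p.2)) ?_ ?_ (by simp) (by simp)
      (fun p _ => swapVars_cauchyFactor K i p)
    all_goals
      rintro ⟨a, b⟩ h
      simp only [mem_erase, mem_stairPairs, ne_eq, Prod.mk.injEq, Equiv.swap_apply_def] at h ⊢
      split_ifs <;> omega
  have hy : map (swapVars j : MvPolynomial ℕ K →ₐ[K] MvPolynomial ℕ K).toRingHom Q = Q := by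
    rw [hQ, map_prod]
    refine Finset.prod_nbij' (fun p => (p.1, Equiv.swap j (j + 1) p.2))
      (fun p => (p.1, Equiv.swap j (j + 1) p.2)) ?_ ?_ (by simp) (by simp)
      (fun p _ => map_swapVars_cauchyFactor K j p)
    all_goals
      rintro ⟨a, b⟩ h
      simp only [mem_erase, mem_stairPairs, ne_eq, Prod.mk.injEq, Equiv.swap_apply_def] at h ⊢
      split_ifs <;> omega
  have hyQ : ∀ m, swapVars j (coeff m Q) = coeff m Q := by
    intro m
    conv_rhs => rw [← hy, coeff_map]
    rfl
  have hyX : ∀ m, swapVars j (coeff m (Q * X i)) = coeff m (Q * X i) := by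
    intro m
    rw [coeff_mul_X']
    split_ifs
    · exact hyQ _
    · exact map_zero _
  have h1 : isobaric i (cauchyFactor K (i, j)) = 1 := by
    refine (eq_isobaric ?_).symm
    rw [swapVars_cauchyFactor]
    simp only [cauchyFactor, Equiv.swap_apply_left, map_sub, map_one]
    ring
  have h2 : coeff m (cauchyProduct K n) =
      coeff m (Q * X i) * 1 + (coeff m Q - coeff m (Q * X i)) * X j := by
    rw [hP, cauchyFactor, mul_add, ← mul_assoc, coeff_add, mul_comm _ (C _), mul_comm _ (C _),
      coeff_C_mul, coeff_C_mul]
    ring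
  rw [h2, isobaric_add, isobaric_mul_of_swapVars (hyX m), isobaric_mul_of_swapVars
    (by rw [map_sub, hyQ, hyX]), isobaric_one, isobaric_X, hP, isobaric_mul_of_swapVars hx, h1,
    mul_one]
  ring

/-! ### The sum side of the Cauchy identity -/

theorem coeff_map_C_mul_C (h : MvPolynomial ℕ K) (g : MvPolynomial ℕ K) (m : ℕ →₀ ℕ) :
    coeff m (map C h * C g : MvPolynomial ℕ (MvPolynomial ℕ K)) = coeff m h • g := by
  rw [mul_comm, coeff_C_mul, coeff_map, smul_eq_C_mul, mul_comm]

/-- Since `s_i w_∘ = w_∘ s_{n-i}`, the terms of `w` and `w s_i` can be grouped. If `w` ascends at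
`i`, both operators turn the pair into `(ℌ_w + ℌ_{ws_i}) 𝔊_{ws_iw_∘}`. -/
theorem coeff_isobaric_dual_sum [IsDomain K] (i : Fin (n - 1)) (m : ℕ →₀ ℕ) :
    coeff m (isobaric ((i : ℕ) + 1) (∑ w : Equiv.Perm (Fin n),
      map C (dualGrothendieck K w) * C (grothendieck K (w * longest n)))) =
    isobaric (n - ((i : ℕ) + 1)) (coeff m (∑ w : Equiv.Perm (Fin n),
      map C (dualGrothendieck K w) * C (grothendieck K (w * longest n)))) := by
  -- The zero-based index of the reflection conjugate to `simple i` under `w_∘`.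
  let i' : Fin (n - 1) := ⟨n - 1 - (i + 1), by omega⟩
  have hi' : n - ((i : ℕ) + 1) = (i' : ℕ) + 1 := by simp only [i']; omega
  have hlo : longest n (lo i') = hi i := by
    rw [longest_apply, Fin.ext_iff, Fin.val_rev, lo_val, hi_val]; simp only [i']; omega
  have hhi : longest n (hi i') = lo i := by
    rw [longest_apply, Fin.ext_iff, Fin.val_rev, lo_val, hi_val]; simp only [i']; omega
  have hconj : longest n * simple i' = simple i * longest n := by
    have := Equiv.swap_apply_apply (longest n) (lo i') (hi i')
    rw [hlo, hhi, Equiv.swap_comm, ← simple_eq, ← simple_eq] at this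
    rw [this, inv_mul_cancel_right]
  rw [hi', ← isobaricLin_apply, ← isobaricLin_apply, map_sum, coeff_sum, coeff_sum, map_sum,
    ← sub_eq_zero, ← Finset.sum_sub_distrib]
  have hterm : ∀ w : Equiv.Perm (Fin n),
      coeff m (isobaricLin _ ((i : ℕ) + 1)
        (map C (dualGrothendieck K w) * C (grothendieck K (w * longest n)))) =
      coeff m (isobaric ((i : ℕ) + 1) (dualGrothendieck K w)) • grothendieck K (w * longest n) := by
    intro w
    rw [isobaricLin_apply, mul_comm, isobaric_mul_of_swapVars (algHom_C _ _), isobaric_map,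
      mul_comm, coeff_map_C_mul_C]
  simp only [hterm, coeff_map_C_mul_C, map_smul]
  simp only [isobaricLin_apply]
  have hpair : ∀ w : Equiv.Perm (Fin n), w (lo i) < w (hi i) →
      coeff m (isobaric ((i : ℕ) + 1) (dualGrothendieck K w)) • grothendieck K (w * longest n) -
        coeff m (dualGrothendieck K w) •
          isobaric ((i' : ℕ) + 1) (grothendieck K (w * longest n)) +
      (coeff m (isobaric ((i : ℕ) + 1) (dualGrothendieck K (w * simple i))) •
          grothendieck K (w * simple i * longest n) -
        coeff m (dualGrothendieck K (w * simple i)) •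
          isobaric ((i' : ℕ) + 1) (grothendieck K (w * simple i * longest n))) = 0 := by
    intro w hw
    have e1 : isobaric ((i' : ℕ) + 1) (grothendieck K (w * longest n)) =
        grothendieck K (w * simple i * longest n) := by
      rw [isobaric_grothendieck_of_gt, mul_assoc, hconj, mul_assoc]
      rwa [Equiv.Perm.mul_apply, Equiv.Perm.mul_apply, hlo, hhi]
    have e2 : isobaric ((i' : ℕ) + 1) (grothendieck K (w * simple i * longest n)) =
        grothendieck K (w * simple i * longest n) := by
      rw [← e1, isobaric_isobaric]
    rw [e1, e2, isobaric_dualGrothendieck_of_lt hw,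
      isobaric_dualGrothendieck_of_gt (w := w * simple i) (by simpa using hw), mul_simple_simple,
      coeff_add, coeff_zero]
    module
  refine Finset.sum_involution (fun w _ => w * simple i) ?_ ?_ ?_ ?_
  · intro w _
    rcases (apply_lo_ne_apply_hi w i).lt_or_gt with h | h
    · exact hpair w h
    · have := hpair (w * simple i) (by simpa using h)
      rwa [mul_simple_simple, add_comm] at this
  · intro w _ _
    exact mul_simple_ne_self w i
  · simp
  · simp

theorem cauchyProduct_eq_sum [IsDomain K] :
    cauchyProduct K n = ∑ w : Equiv.Perm (Fin n),
      map C (dualGrothendieck K w) * C (grothendieck K (w * longest n)) := by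
  rw [← sub_eq_zero]
  refine eq_zero_of_coeff_isobaric (n := n) ?_ ?_ fun i =>
    ⟨isobaric (n - ((i : ℕ) + 1)), map_zero (isobaricLin K _), fun m => ?_⟩
  · refine Submodule.sub_mem _ (cauchyProduct_mem_stairModule K n)
      (Submodule.sum_mem _ fun w _ => ?_)
    rw [map_dualGrothendieck, mul_comm, ← smul_eq_C_mul]
    exact Submodule.smul_mem _ _ (dualGrothendieck_mem_stairModule _ w)
  · rw [coeff_sub, coeff_zero_cauchyProduct, coeff_sum, Finset.sum_eq_single 1]
    · rw [coeff_map_C_mul_C, coeff_zero_dualGrothendieck, if_pos rfl, one_smul, one_mul, sub_self]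
    · intro w _ hw
      rw [coeff_map_C_mul_C, coeff_zero_dualGrothendieck, if_neg hw, zero_smul]
    · simp
  · have h1 := coeff_isobaric_cauchyProduct (K := K) (n := n) (i := (i : ℕ) + 1)
      (j := n - ((i : ℕ) + 1)) (by omega) (by omega) (by omega) m
    have h2 := coeff_isobaric_dual_sum (K := K) i m
    rw [← isobaricLin_apply, ← isobaricLin_apply] at h1 h2 ⊢
    rw [map_sub, coeff_sub, coeff_sub, map_sub, h1, h2]

end Cauchy

/-! ### Quantization of the Cauchy identity -/

section Quantization

theorem cauchyProduct_eq_sum_elem (K : Type*) [CommRing K] (n : ℕ) :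
    cauchyProduct K n = ∑ p : StdIndex n,
      map C (∏ k : Fin n, (X (n - (k : ℕ)) ^ ((k : ℕ) - (p k : ℕ)) *
        (1 - X (n - (k : ℕ))) ^ (p k : ℕ))) * C (stdElem K p) := by
  have hrow : ∀ k : ℕ, ∏ b ∈ Icc 1 k, cauchyFactor K (n - k, b) = ∑ p : Fin (k + 1),
      (X (n - k) ^ (k - (p : ℕ)) * (1 - X (n - k)) ^ (p : ℕ)) * C (elem K k p) := by
    intro k
    have h1 : ∀ b, cauchyFactor K (n - k, b) = X (n - k) - (X (n - k) - 1) * C (X b) := by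
      intro b
      rw [cauchyFactor, map_sub, map_one]
      ring
    -- Writing the factor as `x - (x - 1) y_b` puts the row in the form of `prod_sub_eq_sum`; its
    -- sign `(-1)^p` then turns `(x - 1)^p` into `(1 - x)^p`.
    have h2 : (1 - X (n - k) : MvPolynomial ℕ (MvPolynomial ℕ K)) = -1 * (X (n - k) - 1) := by
      ring
    simp only [h1]
    rw [prod_sub_eq_sum]
    refine Finset.sum_congr rfl fun p _ => ?_
    rw [elem, map_sum, Finset.mul_sum, Finset.mul_sum]
    refine Finset.sum_congr rfl fun I hI => ?_
    rw [Finset.prod_mul_distrib, Finset.prod_const, (mem_powersetCard.1 hI).2, map_prod, h2,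
      mul_pow]
    ring
  have hprod : cauchyProduct K n =
      ∏ k : Fin n, ∏ b ∈ Icc 1 (k : ℕ), cauchyFactor K (n - (k : ℕ), b) := by
    rw [cauchyProduct, Fin.prod_univ_eq_prod_range
      (fun k => ∏ b ∈ Icc 1 k, cauchyFactor K (n - k, b)), Finset.prod_sigma']
    refine Finset.prod_bij' (fun p _ => ⟨n - p.1, p.2⟩) (fun s _ => (n - s.1, s.2)) ?_ ?_ ?_ ?_ ?_
    · intro p hp
      rw [mem_stairPairs] at hp
      simp only [mem_sigma, mem_range, mem_Icc]
      omega
    · rintro ⟨k, b⟩ hs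
      simp only [mem_sigma, mem_range, mem_Icc] at hs
      rw [mem_stairPairs]
      simp only
      omega
    · rintro ⟨a, b⟩ hp
      rw [mem_stairPairs] at hp
      simp only [Prod.mk.injEq, and_true] at hp ⊢
      omega
    · rintro ⟨k, b⟩ hs
      simp only [mem_sigma, mem_range, mem_Icc] at hs
      simp only [Sigma.mk.injEq, heq_eq_eq, and_true]
      omega
    · rintro ⟨a, b⟩ hp
      rw [mem_stairPairs] at hp
      simp only at hp ⊢
      rw [Nat.sub_sub_self (by omega)]
  rw [hprod]
  simp only [hrow]
  rw [Finset.prod_univ_sum, Fintype.piFinset_univ]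
  refine Finset.sum_congr rfl fun p _ => ?_
  rw [Finset.prod_mul_distrib, stdElem, map_prod C]
  simp only [map_prod, map_mul, map_pow, map_sub, map_one, map_X]

/-- Each coefficient in the outer variables is a `K`-linear relation inside `L`, to which `Q`
applies. This makes sense of quantizing in `y` while `x` is kept as parameters. -/
theorem sum_map_mul_C_congr {K : Type*} [CommRing K] {L : Submodule K (MvPolynomial ℕ K)}
    (Q : L →ₗ[K] MvPolynomial ℕ K) {ι κ : Type*} [Fintype ι] [Fintype κ]
    (a : ι → MvPolynomial ℕ K) (e : ι → L) (h : κ → MvPolynomial ℕ K) (g : κ → L)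
    (H : ∑ i, map C (a i) * C (e i : MvPolynomial ℕ K) =
      ∑ j, map C (h j) * C (g j : MvPolynomial ℕ K)) :
    ∑ i, map C (a i) * C (Q (e i)) = ∑ j, map C (h j) * C (Q (g j)) := by
  ext1 m
  have h1 := congrArg (coeff m) H
  simp only [coeff_sum, coeff_map_C_mul_C] at h1 ⊢
  have h2 : ∑ i, coeff m (a i) • e i = ∑ j, coeff m (h j) • g j := by
    apply Subtype.ext
    simpa using h1
  have h3 := congrArg Q h2
  simpa only [map_sum, map_smul] using h3

theorem quantumF_zero (k : ℕ) : quantumF k 0 = 1 := by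
  simp [quantumF]

/-- Collecting the terms with `F_i^k` leaves `(-1)^i (1-x)^i` times the binomial expansion of
`((1-x) + x)^{k-i} = 1`. -/
theorem sum_quantumE (k : ℕ) (x : MvPolynomial ℕ (MvPolynomial ℕ Zq)) :
    ∑ p : Fin (k + 1), x ^ (k - (p : ℕ)) * (1 - x) ^ (p : ℕ) * C (quantumE k p) =
      1 + ∑ j ∈ Icc 1 k, (-1) ^ j * (1 - x) ^ j * C (quantumF k j) := by
  have h1 : 1 + ∑ j ∈ Icc 1 k, (-1) ^ j * (1 - x) ^ j * C (quantumF k j) =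
      ∑ j ∈ range (k + 1), (-1) ^ j * (1 - x) ^ j * C (quantumF k j) := by
    have h2 : range (k + 1) = insert 0 (Icc 1 k) := by
      ext
      simp only [mem_range, mem_insert, mem_Icc]
      omega
    rw [h2, Finset.sum_insert (by simp), quantumF_zero]
    simp
  rw [h1, Fin.sum_univ_eq_sum_range
    (fun p => x ^ (k - p) * (1 - x) ^ p * C (quantumE k p)) (k + 1)]
  simp only [quantumE, map_sum, Finset.mul_sum]
  rw [Finset.sum_comm' (t' := range (k + 1)) (s' := fun i => Ico i (k + 1)) (by
    intro p i
    simp only [mem_range, mem_Ico]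
    omega)]
  refine Finset.sum_congr rfl fun i hi => ?_
  have hik : i ≤ k := Nat.lt_succ_iff.1 (mem_range.1 hi)
  rw [Finset.sum_Ico_eq_sum_range]
  have h3 := add_pow (1 - x) x (k - i)
  rw [sub_add_cancel, one_pow] at h3
  have h4 : (-1) ^ i * (1 - x) ^ i * C (quantumF k i) = (-1) ^ i * (1 - x) ^ i *
      C (quantumF k i) * ∑ r ∈ range (k - i + 1),
        (1 - x) ^ r * x ^ (k - i - r) * ((k - i).choose r : MvPolynomial ℕ (MvPolynomial ℕ Zq)) := by
    rw [← h3, mul_one]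
  rw [h4, Finset.mul_sum, Nat.succ_sub hik]
  refine Finset.sum_congr rfl fun r _ => ?_
  rw [Nat.add_sub_cancel_left, Nat.sub_add_eq, pow_add]
  simp only [map_mul, map_pow, map_neg, map_one, map_natCast]
  ring

theorem quantumDoubleLongest_eq_sum (n : ℕ) :
    quantumDoubleLongest n = ∑ p : StdIndex n,
      map C (∏ k : Fin n, (X (n - (k : ℕ)) ^ ((k : ℕ) - (p k : ℕ)) *
        (1 - X (n - (k : ℕ))) ^ (p k : ℕ))) * C (∏ k : Fin n, quantumE k (p k)) := by
  have h1 : quantumDoubleLongest n = ∏ k : Fin n, ∑ p : Fin ((k : ℕ) + 1),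
      X (n - (k : ℕ)) ^ ((k : ℕ) - (p : ℕ)) * (1 - X (n - (k : ℕ))) ^ (p : ℕ) *
        C (quantumE k p) := by
    simp only [sum_quantumE]
    rw [Fin.prod_univ_eq_prod_range (fun k => 1 + ∑ j ∈ Icc 1 k, (-1) ^ j *
      (1 - X (n - k)) ^ j * C (quantumF k j)), quantumDoubleLongest]
    refine Finset.prod_subset ?_ ?_
    · intro k hk
      rw [mem_Icc] at hk
      rw [mem_range]
      omega
    · intro k hk hk'
      rw [mem_range] at hk
      rw [mem_Icc] at hk'
      -- The row `k = 0` exists only in the index set of standard monomials; its factor is `1`.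
      obtain rfl : k = 0 := by omega
      simp
  rw [h1, Finset.prod_univ_sum, Fintype.piFinset_univ]
  refine Finset.sum_congr rfl fun p _ => ?_
  rw [Finset.prod_mul_distrib, map_prod C]
  simp only [map_prod, map_mul, map_pow, map_sub, map_one, map_X]

end Quantization

end QuantumGrothendieck

end

/-- The Cauchy identity in `ℤ[q][y][x]`: the variables of `ℌ_w` are the outer variables `x`, the
quantum Grothendieck polynomials are taken in the inner variables `y`. -/
theorem mainTheorem6 (n : ℕ) :
    QuantumGrothendieck.quantumDoubleGrothendieck (QuantumGrothendieck.longest n) =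
      ∑ w : Equiv.Perm (Fin n),
        QuantumGrothendieck.dualGrothendieck
            (MvPolynomial ℕ QuantumGrothendieck.Zq) w *
          MvPolynomial.C
            (QuantumGrothendieck.quantumGrothendieck (w * QuantumGrothendieck.longest n)) := by
  open QuantumGrothendieck in
  have H := sum_map_mul_C_congr (quantization n)
    (fun p : StdIndex n => ∏ k : Fin n, (MvPolynomial.X (n - (k : ℕ)) ^ ((k : ℕ) - (p k : ℕ)) *
        (1 - MvPolynomial.X (n - (k : ℕ))) ^ (p k : ℕ)))
    (fun p => stdBasis Zq n p) (fun w : Equiv.Perm (Fin n) => dualGrothendieck Zq w)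
    (fun w => ⟨grothendieck Zq (w * longest n), grothendieck_mem_stairModule Zq _⟩)
    (by
      simp only [coe_stdBasis]
      rw [← cauchyProduct_eq_sum_elem, cauchyProduct_eq_sum])
  -- Base change along `C` turns `ℌ_w` over `ℤ[q]` into `ℌ_w` over `ℤ[q][y]`, and quantization is
  -- evaluated on its defining basis.
  simp only [QuantumGrothendieck.map_dualGrothendieck, QuantumGrothendieck.quantization,
    Module.Basis.constr_basis] at H
  rw [QuantumGrothendieck.quantumDoubleGrothendieck_longest,
    QuantumGrothendieck.quantumDoubleLongest_eq_sum, H]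
  rfl
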